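/- Let $\Omega\subset\mathbb{R}^n$ be open, let $f:\Omega\to\mathbb{R}^n$ be real analytic, and let $x_0(t)$ be a non-constant periodic solution of $\dot x=f(x)$ with (not necessarily minimal) period $T>0$. Assume that the Floquet multipliers $\mu_1,\dots,\mu_n$ of the $T$-periodic variational equation $\dot y=f'(x_0(t))y$, counted with multiplicity, satisfy $\mu_1=1$ and $|\mu_2|<1,\dots,|\mu_n|<1$, and let $z_0$ be the (unique) $T$-periodic solution of the adjoint equation $\dot z=-f'(x_0(t))^*z$ with $\langle\dot x_0(t),z_0(t)\rangle=1$ for all $t\in\mathbb{R}$. Let $\varepsilon_*>0$ and let $g:\mathbb{R}\times\Omega\times[0,\varepsilon_*]\to\mathbb{R}^n$ be continuous and $T$-periodic in $t$. Assume that, for each $t$, $g(t,\cdot,\cdot)$ has partial derivatives up to second order with respect to $(x,\varepsilon)$ and that these are continuous in $(t,x,\varepsilon)$. Assume moreover that $g$ is analytic in $x$ in the following sense: for each $x_*\in\Omega$ there are $r>0$ with $B_r(x_*)\subset\Omega$ and coefficients $g_\alpha(t,\varepsilon)\in\mathbb{R}^n$, $\alpha\in\mathbb{N}^n$, continuous and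 $T$-periodic in $t$, such that for $\|x-x_*\|<r$ $$g(t,x,\varepsilon)=\sum_{\alpha\in\mathbb{N}^n}g_\alpha(t,\varepsilon)(x-x_*)^\alpha,\qquad t\in\mathbb{R},\ \varepsilon\in[0,\varepsilon_*],$$ the convergence being uniform in $t$ and $\varepsilon$. Put $$M(\theta)=\int_0^T\langle g(t,x_0(t+\theta),0),z_0(t+\theta)\rangle\,dt,\qquad\theta\in\mathbb{R}.$$ For $\varepsilon\in[0,\varepsilon_*]$ let $\mathcal{P}_\varepsilon$ be the Poincaré map $\zeta\mapsto x(T;\zeta,\varepsilon)$, where $x(t;\zeta,\varepsilon)$ is the solution of $$\dot x=f(x)+\varepsilon g(t,x,\varepsilon),\qquad x(0)=\zeta ,$$ defined for those $\zeta\in\Omega$ for which this solution exists on $[0,T]$. If $\theta_0\in\mathbb{R}$ is an isolated zero of $M$, then there exist $\varepsilon_0\in(0,\varepsilon_*]$ and $R>0$ such that for every $\varepsilon\in(0,\varepsilon_0)$ the map $\mathcal{P}_\varepsilon$ is defined on the whole open ball $B_R(x_0(\theta_0))$ and has at most finitely many fixed points in it. -/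

import Mathlib

noncomputable section

/-- `Y` is the principal matrix solution (`Y 0 = id`) of the linear system `y' = A(t) y`. -/
def IsPrincipalSolution {n : ℕ}
    (A : ℝ → (EuclideanSpace ℝ (Fin n) →L[ℝ] EuclideanSpace ℝ (Fin n)))
    (Y : ℝ → (EuclideanSpace ℝ (Fin n) →L[ℝ] EuclideanSpace ℝ (Fin n))) : Prop :=
  Y 0 = ContinuousLinearMap.id ℝ (EuclideanSpace ℝ (Fin n)) ∧
    ∀ t : ℝ, HasDerivAt Y ((A t).comp (Y t)) t

/-- `m` is the multiset of Floquet multipliers of the `T`-periodic linear system `y' = A(t) y`: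
the complex eigenvalues, with algebraic multiplicity, of the monodromy operator `Y T`. -/
def IsFloquetMultipliers {n : ℕ}
    (A : ℝ → (EuclideanSpace ℝ (Fin n) →L[ℝ] EuclideanSpace ℝ (Fin n)))
    (T : ℝ) (m : Multiset ℂ) : Prop :=
  ∃ Y : ℝ → (EuclideanSpace ℝ (Fin n) →L[ℝ] EuclideanSpace ℝ (Fin n)),
    IsPrincipalSolution A Y ∧ m = (Y T).toLinearMap.charpoly.aroots ℂ

/-- `x₀` is a non-constant `T`-periodic solution, with values in `Ω`, of `x' = f(x)`. -/
structure IsNonconstantPeriodicSolution {n : ℕ} (Ω : Set (EuclideanSpace ℝ (Fin n)))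
    (f : EuclideanSpace ℝ (Fin n) → EuclideanSpace ℝ (Fin n)) (T : ℝ)
    (x₀ : ℝ → EuclideanSpace ℝ (Fin n)) : Prop where
  mem : ∀ t, x₀ t ∈ Ω
  ode : ∀ t, HasDerivAt x₀ (f (x₀ t)) t
  periodic : Function.Periodic x₀ T
  nonconstant : ∃ s t, x₀ s ≠ x₀ t

/-- The Floquet multipliers of the variational equation `y' = f'(x₀(t)) y` are
`μ₁ = 1` and `μ₂, …, μₙ` with `|μᵢ| < 1`. -/
def FloquetCondition {n : ℕ} (f : EuclideanSpace ℝ (Fin n) → EuclideanSpace ℝ (Fin n)) (T : ℝ)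
    (x₀ : ℝ → EuclideanSpace ℝ (Fin n)) : Prop :=
  ∃ s : Multiset ℂ, IsFloquetMultipliers (fun t => fderiv ℝ f (x₀ t)) T (1 ::ₘ s) ∧
    ∀ μ ∈ s, ‖μ‖ < 1

/-- `z₀` is the `T`-periodic solution of the adjoint system `z' = -f'(x₀(t))* z` normalized by
`⟨x₀'(t), z₀(t)⟩ = 1` for all `t`. -/
structure IsNormalizedAdjointSolution {n : ℕ}
    (f : EuclideanSpace ℝ (Fin n) → EuclideanSpace ℝ (Fin n)) (T : ℝ)
    (x₀ z₀ : ℝ → EuclideanSpace ℝ (Fin n)) : Prop where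
  ode : ∀ t, HasDerivAt z₀ (-(ContinuousLinearMap.adjoint (fderiv ℝ f (x₀ t)) (z₀ t))) t
  periodic : Function.Periodic z₀ T
  normalized : ∀ t, inner ℝ (deriv x₀ t) (z₀ t) = 1

/-- The regularity assumed of the perturbation `g : ℝ × Ω × [0, εs] → ℝⁿ`: it is continuous,
`T`-periodic in `t`, has derivatives up to order two in `(x, ε)` (one-sided in `ε` at the
end points) which are continuous in `(t, x, ε)`, and is analytic in `x` in the sense that near each
`x'` in `Ω` it is the sum of a power series in `x - x'` whose coefficients are continuous and
`T`-periodic in `t`, the convergence being uniform in `(t, ε)`. -/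
structure IsAdmissiblePerturbation {n : ℕ} (Ω : Set (EuclideanSpace ℝ (Fin n))) (T εs : ℝ)
    (g : ℝ → EuclideanSpace ℝ (Fin n) → ℝ → EuclideanSpace ℝ (Fin n)) : Prop where
  continuousOn : ContinuousOn
    (fun q : ℝ × EuclideanSpace ℝ (Fin n) × ℝ => g q.1 q.2.1 q.2.2)
    (Set.univ ×ˢ (Ω ×ˢ Set.Icc 0 εs))
  periodic : ∀ t, ∀ x ∈ Ω, ∀ ε ∈ Set.Icc 0 εs, g (t + T) x ε = g t x ε
  contDiffOn : ∀ t, ContDiffOn ℝ 2 (fun p : EuclideanSpace ℝ (Fin n) × ℝ => g t p.1 p.2)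
    (Ω ×ˢ Set.Icc 0 εs)
  continuousOn_derivatives : ∀ k : ℕ, k ≤ 2 → ContinuousOn
    (fun q : ℝ × EuclideanSpace ℝ (Fin n) × ℝ =>
      iteratedFDerivWithin ℝ k (fun p : EuclideanSpace ℝ (Fin n) × ℝ => g q.1 p.1 p.2)
        (Ω ×ˢ Set.Icc 0 εs) q.2)
    (Set.univ ×ˢ (Ω ×ˢ Set.Icc 0 εs))
  analytic : ∀ x' ∈ Ω, ∃ r > 0, Metric.ball x' r ⊆ Ω ∧
    ∃ a : (Fin n → ℕ) → ℝ → ℝ → EuclideanSpace ℝ (Fin n),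
      (∀ α, ∀ ε ∈ Set.Icc 0 εs,
        Continuous (fun t => a α t ε) ∧ Function.Periodic (fun t => a α t ε) T) ∧
      ∀ x ∈ Metric.ball x' r, TendstoUniformlyOn
        (fun (S : Finset (Fin n → ℕ)) (p : ℝ × ℝ) =>
          ∑ α ∈ S, (∏ i, (x i - x' i) ^ α i) • a α p.1 p.2)
        (fun p => g p.1 x p.2) Filter.atTop (Set.univ ×ˢ Set.Icc 0 εs)

/-- The bifurcation function `M(θ) = ∫₀ᵀ ⟨g(t, x₀(t+θ), 0), z₀(t+θ)⟩ dt`. -/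
def malkinFunction {n : ℕ} (T : ℝ)
    (g : ℝ → EuclideanSpace ℝ (Fin n) → ℝ → EuclideanSpace ℝ (Fin n))
    (x₀ z₀ : ℝ → EuclideanSpace ℝ (Fin n)) (θ : ℝ) : ℝ :=
  ∫ t in (0 : ℝ)..T, inner ℝ (g t (x₀ (t + θ)) 0) (z₀ (t + θ))

/-- `θ₀` is an isolated zero of `M`. -/
def IsIsolatedZero (M : ℝ → ℝ) (θ₀ : ℝ) : Prop :=
  M θ₀ = 0 ∧ ∀ᶠ θ in nhdsWithin θ₀ {θ₀}ᶜ, M θ ≠ 0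

/-- The right-hand side `f(x) + ε g(t, x, ε)` of the perturbed system. -/
def perturbedField {n : ℕ} (f : EuclideanSpace ℝ (Fin n) → EuclideanSpace ℝ (Fin n))
    (g : ℝ → EuclideanSpace ℝ (Fin n) → ℝ → EuclideanSpace ℝ (Fin n)) (ε : ℝ)
    (t : ℝ) (x : EuclideanSpace ℝ (Fin n)) : EuclideanSpace ℝ (Fin n) :=
  f x + ε • g t x ε

/-- `x` is a solution in `Ω`, on the time interval `[0, T]`, of `x' = F(t, x)`, `x(0) = ζ`. -/
structure IsSolutionFrom {n : ℕ} (Ω : Set (EuclideanSpace ℝ (Fin n)))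
    (F : ℝ → EuclideanSpace ℝ (Fin n) → EuclideanSpace ℝ (Fin n)) (T : ℝ)
    (ζ : EuclideanSpace ℝ (Fin n)) (x : ℝ → EuclideanSpace ℝ (Fin n)) : Prop where
  init : x 0 = ζ
  mem : ∀ t ∈ Set.Icc 0 T, x t ∈ Ω
  ode : ∀ t ∈ Set.Icc 0 T, HasDerivWithinAt x (F t (x t)) (Set.Icc 0 T) t

/-- The initial conditions whose solution is defined on the whole of `[0, T]`. -/
def poincareDomain {n : ℕ} (Ω : Set (EuclideanSpace ℝ (Fin n)))
    (F : ℝ → EuclideanSpace ℝ (Fin n) → EuclideanSpace ℝ (Fin n)) (T : ℝ) :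
    Set (EuclideanSpace ℝ (Fin n)) :=
  {ζ | ∃ x, IsSolutionFrom Ω F T ζ x}

open Classical in
/-- The Poincaré map `ζ ↦ x(T; ζ)`; it is meaningful on `poincareDomain Ω F T` (and set to the
junk value `0` elsewhere). -/
def poincareMap {n : ℕ} (Ω : Set (EuclideanSpace ℝ (Fin n)))
    (F : ℝ → EuclideanSpace ℝ (Fin n) → EuclideanSpace ℝ (Fin n)) (T : ℝ)
    (ζ : EuclideanSpace ℝ (Fin n)) : EuclideanSpace ℝ (Fin n) :=
  if h : ∃ x, IsSolutionFrom Ω F T ζ x then h.choose T else 0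

end

/-! For fixed `ε` the Poincaré map is real analytic near `x₀ θ₀`, so infinitely many fixed points in
a small ball would force a whole arc of them; Malkin's necessary condition forbids such an arc.

The map is Lipschitz-close to the monodromy operator `B`, for which `1` is a simple eigenvalue with
eigenvector `f (x₀ θ₀)` and left eigenvector `z₀ θ₀`. Lyapunov–Schmidt reduction
(`exists_lyapunovSchmidt_alternative`) places the fixed points on an analytic arc, as the zeros of a
scalar analytic function. If there are infinitely many, these zeros accumulate, the function
vanishes identically and every point of the arc is fixed. Each `x₀ θ` near `x₀ θ₀` moves by only
`O(ε)` under the map, so the arc passes within `O(ε)` of it. But `θ₀` is an isolated zero of `M`, so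
some such `θ₁` has `M θ₁ ≠ 0`, and then there is no fixed point within `O(ε)` of `x₀ θ₁` for small
`ε` (`IsFlowBound.eventually_not_isFixedPt`).

Analyticity in the initial value (`analyticAt_solution`) comes from the integral equation: the
superposition operator is analytic on continuous functions, and over short times the inverse
function theorem applies. Analyticity in `ε` is never needed. Compactness of the orbit and
Grönwall's inequality give the remaining estimates uniformly in the phase. -/

open Set Filter Topology Metric

/-! ### Analytic dependence of solutions on parameters. -/

section AnalyticDependence

variable {E : Type*} [NormedAddCommGroup E] [NormedSpace ℝ E]

/-- Near `c`, the time-dependent field `F` is the sum of a power series whose coefficients are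
continuous in time and satisfy Cauchy estimates uniformly in time. -/
def UniformlyAnalyticAt (F : ℝ → E → E) (c : E) : Prop :=
  ∃ ρ > 0, ∃ C : ℝ, ∃ p : ℝ → FormalMultilinearSeries ℝ E E,
    (∀ k, Continuous fun t => p t k) ∧ (∀ t k, ‖p t k‖ * ρ ^ k ≤ C) ∧
    ∀ t y, ‖y‖ < ρ → HasSum (fun k => p t k fun _ => y) (F t (c + y))

/-- The multilinear map on continuous functions obtained by applying a continuous family of
multilinear maps pointwise. -/
noncomputable def pointwiseMultilinear {K : Type*} [TopologicalSpace K] [CompactSpace K] {k : ℕ}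
    (P : C(K, ContinuousMultilinearMap ℝ (fun _ : Fin k => E) E)) :
    ContinuousMultilinearMap ℝ (fun _ : Fin k => C(K, E)) C(K, E) :=
  MultilinearMap.mkContinuous
    { toFun := fun h => ⟨fun s => P s fun j => h j s, by
        have h1 : Continuous fun s => (fun j => h j s : Fin k → E) := by fun_prop
        exact P.continuous.eval h1⟩
      map_update_add' := by
        intro _ h i u v
        ext s
        have key : ∀ w : C(K, E), (fun j => (Function.update h i w) j s) =
            Function.update (fun j => h j s) i (w s) := by
          intro w
          ext j
          by_cases hj : j = i
          · subst hj; simp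
          · simp [hj]
        simp [key]
      map_update_smul' := by
        intro _ h i a u
        ext s
        have key : ∀ w : C(K, E), (fun j => (Function.update h i w) j s) =
            Function.update (fun j => h j s) i (w s) := by
          intro w
          ext j
          by_cases hj : j = i
          · subst hj; simp
          · simp [hj]
        simp [key] }
    ‖P‖ (by
      intro h
      rw [ContinuousMap.norm_le _ (by positivity)]
      intro s
      calc ‖P s fun j => h j s‖ ≤ ‖P s‖ * ∏ j, ‖h j s‖ := (P s).le_opNorm _
        _ ≤ ‖P‖ * ∏ j, ‖h j‖ := by
          gcongr
          · exact P.norm_coe_le_norm s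
          · exact (h _).norm_coe_le_norm s)

theorem norm_pointwiseMultilinear_le {K : Type*} [TopologicalSpace K] [CompactSpace K] {k : ℕ}
    (P : C(K, ContinuousMultilinearMap ℝ (fun _ : Fin k => E) E)) :
    ‖pointwiseMultilinear P‖ ≤ ‖P‖ :=
  MultilinearMap.mkContinuous_norm_le _ (norm_nonneg P) _

/-- The superposition operator `h ↦ F(·, c + h(·))` of a uniformly analytic field is analytic for
the supremum norm. -/
theorem UniformlyAnalyticAt.exists_superposition [CompleteSpace E] {F : ℝ → E → E} {c : E}
    (hF : UniformlyAnalyticAt F c) (a b : ℝ) :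
    ∃ ρ > 0, ∃ N : C(Icc a b, E) → C(Icc a b, E), AnalyticOnNhd ℝ N (ball 0 ρ) ∧
      ∀ h ∈ ball (0 : C(Icc a b, E)) ρ, ∀ s : Icc a b, N h s = F s (c + h s) := by
  obtain ⟨ρ, hρ, C, p, hpc, hpb, hps⟩ := hF
  -- The Cauchy estimates are uniform in time, so the supremum norm of the `k`-th coefficient obeys
  -- the same bound and the series on continuous functions has radius at least `ρ`.
  let q : FormalMultilinearSeries ℝ C(Icc a b, E) C(Icc a b, E) := fun k =>
    pointwiseMultilinear ⟨fun s : Icc a b => p s k, (hpc k).comp continuous_subtype_val⟩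
  have hC : 0 ≤ C := (by positivity : (0:ℝ) ≤ ‖p 0 0‖ * ρ ^ 0).trans (hpb 0 0)
  have hqb : ∀ k, ‖q k‖ * ρ ^ k ≤ C := by
    intro k
    rw [← le_div_iff₀ (by positivity)]
    refine (norm_pointwiseMultilinear_le _).trans ?_
    rw [ContinuousMap.norm_le _ (by positivity)]
    intro s
    rw [le_div_iff₀ (by positivity)]
    exact hpb s k
  have hrad : ENNReal.ofReal ρ ≤ q.radius := by
    have := q.le_radius_of_bound (r := ρ.toNNReal) C (fun k => by
      simpa [Real.coe_toNNReal ρ hρ.le] using hqb k)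
    simpa [ENNReal.ofReal] using this
  have hpos : 0 < q.radius := lt_of_lt_of_le (by simpa using hρ) hrad
  have hsum := q.hasFPowerSeriesOnBall hpos
  have hball : ∀ h ∈ ball (0 : C(Icc a b, E)) ρ, h ∈ Metric.eball (0 : C(Icc a b, E)) q.radius := by
    intro h hh
    rw [Metric.mem_eball, edist_dist]
    refine lt_of_lt_of_le ?_ hrad
    exact (ENNReal.ofReal_lt_ofReal_iff hρ).2 hh
  refine ⟨ρ, hρ, q.sum, fun h hh => hsum.analyticAt_of_mem (hball h hh), fun h hh s => ?_⟩
  have h1 := hsum.hasSum (hball h hh)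
  rw [zero_add] at h1
  have h2 := h1.mapL (ContinuousMap.evalCLM ℝ s)
  have h3 := hps s (h s) (lt_of_le_of_lt (h.norm_coe_le_norm s) (by simpa using hh))
  exact h2.unique h3

/-- Integration from `s` of continuous functions on `[a, b]`, stopped at time `t`. -/
noncomputable def stoppedIntegral [CompleteSpace E] {a b : ℝ} (hab : a ≤ b) {s t : ℝ} (hst : s ≤ t) :
    C(Icc a b, E) →L[ℝ] C(Icc a b, E) :=
  LinearMap.mkContinuous
    { toFun := fun h => ⟨fun τ => ∫ σ in s..(projIcc s t hst τ : ℝ), IccExtend hab h σ, by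
        have h1 : Continuous fun u : ℝ => ∫ σ in s..u, IccExtend hab h σ :=
          intervalIntegral.continuous_primitive (fun u v => Continuous.intervalIntegrable
            (h.continuous.Icc_extend' ) u v) s
        exact h1.comp (by fun_prop)⟩
      map_add' := by
        intro h k
        ext τ
        have hi : ∀ h : C(Icc a b, E), IntervalIntegrable (IccExtend hab h) MeasureTheory.volume s
            (projIcc s t hst τ : ℝ) := fun h =>
          Continuous.intervalIntegrable (h.continuous.Icc_extend' ) _ _
        simp only [ContinuousMap.coe_mk, ContinuousMap.add_apply]
        rw [← intervalIntegral.integral_add (hi h) (hi k)]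
        rfl
      map_smul' := by
        intro r h
        ext τ
        simp only [ContinuousMap.coe_mk, ContinuousMap.smul_apply, RingHom.id_apply]
        rw [← intervalIntegral.integral_smul]
        rfl }
    (t - s) (by
      intro h
      rw [ContinuousMap.norm_le _ (mul_nonneg (sub_nonneg.2 hst) (norm_nonneg _))]
      intro τ
      have h1 : ‖∫ σ in s..(projIcc s t hst τ : ℝ), IccExtend hab h σ‖
          ≤ ‖h‖ * |(projIcc s t hst τ : ℝ) - s| :=
        intervalIntegral.norm_integral_le_of_norm_le_const fun σ _ => h.norm_coe_le_norm _
      refine h1.trans ?_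
      rw [mul_comm]
      gcongr
      rw [abs_of_nonneg (sub_nonneg.2 (projIcc s t hst τ).2.1)]
      linarith [(projIcc s t hst τ).2.2])

theorem stoppedIntegral_apply [CompleteSpace E] {a b : ℝ} (hab : a ≤ b) {s t : ℝ} (hst : s ≤ t)
    (h : C(Icc a b, E)) (τ : Icc a b) :
    stoppedIntegral hab hst h τ = ∫ σ in s..(projIcc s t hst τ : ℝ), IccExtend hab h σ := rfl

theorem norm_stoppedIntegral_le [CompleteSpace E] {a b : ℝ} (hab : a ≤ b) {s t : ℝ} (hst : s ≤ t) :
    ‖stoppedIntegral (E := E) hab hst‖ ≤ t - s :=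
  LinearMap.mkContinuous_norm_le _ (sub_nonneg.2 hst) _

variable {G : Type*} [NormedAddCommGroup G] [NormedSpace ℝ G]

/-- A continuous solution `h` of the equation `h - V (N h) = k` is analytic if `N` and `k` are and
`V ∘ N` is infinitesimally contracting. -/
theorem analyticAt_of_sub_comp_eq {X : Type*} [NormedAddCommGroup X] [NormedSpace ℝ X]
    [CompleteSpace X] {N : X → X} {V : X →L[ℝ] X} {h k : G → X} {p : G}
    (hN : AnalyticAt ℝ N (h p)) (hVN : ‖V‖ * ‖fderiv ℝ N (h p)‖ < 1) (hh : ContinuousAt h p)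
    (hk : AnalyticAt ℝ k p) (heq : ∀ᶠ ζ in 𝓝 p, h ζ - V (N (h ζ)) = k ζ) :
    AnalyticAt ℝ h p := by
  -- The derivative of `H` is `1 - V N'`, invertible by a Neumann series, so `H` has an analytic
  -- local inverse. Continuity of `h` keeps it on that branch, where `h = H⁻¹ ∘ k`.
  let H : X → X := fun u => u - V (N u)
  have hHa : AnalyticAt ℝ H (h p) := analyticAt_id.sub ((V.analyticAt _).comp hN)
  let A := V.comp (fderiv ℝ N (h p))
  have hA : ‖A‖ < 1 := (ContinuousLinearMap.opNorm_comp_le _ _).trans_lt hVN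
  let i : X ≃L[ℝ] X := ContinuousLinearEquiv.unitsEquiv ℝ _ (Units.oneSub A hA)
  have hi : (i : X →L[ℝ] X) = 1 - A := by
    ext u; rfl
  have hHd : fderiv ℝ H (h p) = i := by
    rw [hi]
    have h1 : HasFDerivAt H (ContinuousLinearMap.id ℝ _ - V.comp (fderiv ℝ N (h p))) (h p) :=
      (hasFDerivAt_id _).sub (V.hasFDerivAt.comp _ hN.differentiableAt.hasFDerivAt)
    exact h1.fderiv
  have hHs : HasStrictFDerivAt H (i : X →L[ℝ] X) (h p) := by
    rw [← hHd]; exact hHa.hasStrictFDerivAt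
  let R := hHs.toOpenPartialHomeomorph H
  have hRs : h p ∈ R.source := hHs.mem_toOpenPartialHomeomorph_source
  have hRa : AnalyticAt ℝ R.symm (H (h p)) := R.analyticAt_symm' hRs hHa hHd
  have hRa' : AnalyticAt ℝ R.symm (k p) := by rw [← heq.self_of_nhds]; exact hRa
  refine (hRa'.comp hk).congr ?_
  filter_upwards [heq, hh.eventually (R.open_source.mem_nhds hRs)] with ζ h2 h3
  rw [Function.comp_apply, ← h2]
  exact R.left_inv h3

/-- Over a short time interval, solutions depend analytically on a parameter at the end of the
interval if they do so at its beginning. -/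
theorem UniformlyAnalyticAt.exists_analyticAt_step [CompleteSpace E] {F : ℝ → E → E} {T : ℝ}
    (hT : 0 ≤ T) {x : G → ℝ → E} {p : G}
    (hode : ∀ᶠ ζ in 𝓝 p, ∀ t ∈ Icc 0 T, HasDerivWithinAt (x ζ) (F t (x ζ t)) (Icc 0 T) t)
    (hunif : TendstoUniformlyOn x (x p) (𝓝 p) (Icc 0 T)) {r : ℝ} (hr : r ∈ Icc 0 T)
    (hF : UniformlyAnalyticAt F (x p r)) :
    ∃ δ > 0, ∀ s ∈ Icc 0 T, ∀ t ∈ Icc 0 T, s ≤ t → |s - r| < δ → |t - r| < δ →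
      AnalyticAt ℝ (fun ζ => x ζ s) p → AnalyticAt ℝ (fun ζ => x ζ t) p := by
  obtain ⟨ρ, hρ, N, hN, hNF⟩ := hF.exists_superposition 0 T
  set c := x p r with hc
  obtain ⟨ρ', hρ', hρρ, L, hL, hLb⟩ : ∃ ρ' > 0, ρ' ≤ ρ ∧ ∃ L > 0, ∀ h ∈ ball 0 ρ', ‖fderiv ℝ N h‖ ≤ L := by
    have h0 : ContinuousAt (fun h => ‖fderiv ℝ N h‖) 0 :=
      ((hN 0 (by simpa)).fderiv.continuousAt).norm
    have h1 := h0.eventually (gt_mem_nhds (lt_add_one _))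
    obtain ⟨ρ₁, hρ₁, h2⟩ := Metric.eventually_nhds_iff_ball.1 h1
    exact ⟨min ρ₁ ρ, lt_min hρ₁ hρ, min_le_right _ _, _, by positivity,
      fun h hh => (h2 h (ball_subset_ball (min_le_left _ _) hh)).le⟩
  have hxc : ContinuousOn (x p) (Icc 0 T) := fun t ht =>
    (hode.self_of_nhds t ht).continuousWithinAt
  obtain ⟨δ₁, hδ₁, hδ₁c⟩ := Metric.continuousWithinAt_iff.1 (hxc r hr) (ρ' / 2) (by positivity)
  -- Two points within `1 / (4 * L)` of `r` are at most `1 / (2 * L)` apart, which makes the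
  -- integral operator contract by `1 / 2`.
  refine ⟨min δ₁ (1 / (4 * L)), by positivity, fun s hs t ht hst hsr htr hsa => ?_⟩
  have hsr1 := lt_of_lt_of_le hsr (min_le_left _ _)
  have htr1 := lt_of_lt_of_le htr (min_le_left _ _)
  have hts : (t - s) * L ≤ 1 / 2 := by
    have h1 := lt_of_lt_of_le hsr (min_le_right _ _)
    have h2 := lt_of_lt_of_le htr (min_le_right _ _)
    rw [abs_lt] at h1 h2
    have h3 : t - s ≤ 1 / (2 * L) := by
      have : 1 / (2 * L) = 1 / (4 * L) + 1 / (4 * L) := by field_simp; norm_num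
      linarith
    calc (t - s) * L ≤ 1 / (2 * L) * L := by gcongr
      _ = 1 / 2 := by field_simp
  have hsub : Icc s t ⊆ Icc 0 T := Icc_subset_Icc hs.1 ht.2
  -- Stopping the integral at `t` allows one function space on `[0, T]` for all subintervals, while
  -- the norm is still at most `t - s`.
  set V := stoppedIntegral (E := E) hT hst with hV
  classical
  -- The deviation from `c`, frozen before `s` and after `t`. The default `0` is irrelevant: near
  -- `p` every `x ζ` is continuous.
  let h : G → C(Icc 0 T, E) := fun ζ =>
    if hζ : ContinuousOn (x ζ) (Icc 0 T) then
      ⟨fun τ => x ζ (projIcc s t hst τ) - c,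
        (hζ.comp_continuous (f := fun τ : Icc 0 T => (projIcc s t hst τ : ℝ)) (by fun_prop)
          fun τ => hsub (projIcc s t hst τ).2).sub continuous_const⟩
    else 0
  have happly : ∀ᶠ ζ in 𝓝 p, ∀ τ, h ζ τ = x ζ (projIcc s t hst τ) - c := by
    filter_upwards [hode] with ζ hζ τ
    have : ContinuousOn (x ζ) (Icc 0 T) := fun t ht => (hζ t ht).continuousWithinAt
    simp [h, this]
  have htend : Tendsto h (𝓝 p) (𝓝 (h p)) := by
    rw [Metric.tendsto_nhds]
    intro ε hε
    filter_upwards [happly, Metric.tendstoUniformlyOn_iff.1 hunif (ε / 2) (by positivity)]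
      with ζ h1 h2
    have h3 := happly.self_of_nhds
    refine lt_of_le_of_lt ((ContinuousMap.dist_le (by positivity)).2 fun τ => ?_)
      (half_lt_self hε)
    rw [h1, h3, dist_sub_right, dist_comm]
    exact (h2 _ (hsub (projIcc s t hst τ).2)).le
  have hball : h p ∈ ball 0 ρ' := by
    rw [mem_ball_zero_iff]
    refine lt_of_le_of_lt ((ContinuousMap.norm_le _ (by positivity)).2 fun τ => ?_)
      (half_lt_self hρ')
    rw [happly.self_of_nhds, ← dist_eq_norm]
    refine (hδ₁c (hsub (projIcc s t hst τ).2) ?_).le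
    have h1 := (projIcc s t hst τ).2.1
    have h2 := (projIcc s t hst τ).2.2
    rw [abs_lt] at hsr1 htr1
    rw [Real.dist_eq, abs_lt]
    constructor <;> linarith
  have hballρ : ∀ᶠ ζ in 𝓝 p, h ζ ∈ ball 0 ρ :=
    htend.eventually (isOpen_ball.mem_nhds (ball_subset_ball hρρ hball))
  have hNp : AnalyticAt ℝ N (h p) := hN _ (ball_subset_ball hρρ hball)
  have hsmall : ‖V‖ * ‖fderiv ℝ N (h p)‖ < 1 := by
    have h1 : ‖V‖ ≤ t - s := norm_stoppedIntegral_le hT hst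
    have h2 := hLb _ hball
    have h3 := mul_le_mul h1 h2 (norm_nonneg (fderiv ℝ N (h p))) (sub_nonneg.2 hst)
    linarith
  let k : G → C(Icc 0 T, E) := fun ζ => ContinuousMap.const (Icc 0 T) (x ζ s - c)
  have hHk : ∀ᶠ ζ in 𝓝 p, h ζ - V (N (h ζ)) = k ζ := by
    filter_upwards [hode, happly, hballρ] with ζ h1 h2 h3
    ext τ
    have hτ := (projIcc s t hst τ).2
    have hi : V (N (h ζ)) τ = x ζ (projIcc s t hst τ) - x ζ s := by
      rw [hV, stoppedIntegral_apply]
      refine intervalIntegral.integral_eq_sub_of_hasDeriv_right_of_le hτ.1 ?_ ?_ ?_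
      · exact fun u hu => ((h1 u (hsub ⟨hu.1, hu.2.trans hτ.2⟩)).continuousWithinAt).mono
          fun v hv => hsub ⟨hv.1, hv.2.trans hτ.2⟩
      · intro u hu
        have hu' : u ∈ Icc s t := ⟨hu.1.le, hu.2.le.trans hτ.2⟩
        have h4 : IccExtend hT (N (h ζ)) u = F u (x ζ u) := by
          rw [IccExtend_of_mem hT _ (hsub hu'), hNF _ h3, h2]
          simp only [projIcc_of_mem hst hu', add_sub_cancel]
        rw [h4]
        refine (h1 u (hsub hu')).mono_of_mem_nhdsWithin ?_
        refine mem_nhdsWithin_of_mem_nhds (Icc_mem_nhds ?_ ?_)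
        · exact lt_of_le_of_lt hs.1 hu.1
        · exact lt_of_lt_of_le hu.2 (hτ.2.trans ht.2)
      · exact Continuous.intervalIntegrable ((N (h ζ)).continuous.Icc_extend' ) _ _
    simp only [k, ContinuousMap.sub_apply, hi, h2, ContinuousMap.const_apply]
    abel
  have hka : AnalyticAt ℝ k p := by
    have h1 : AnalyticAt ℝ (fun ζ => x ζ s - c) p := hsa.sub analyticAt_const
    exact ((ContinuousLinearMap.const ℝ (Icc (0:ℝ) T) : E →L[ℝ] C(Icc 0 T, E)).analyticAt _).comp h1
  have hha : AnalyticAt ℝ h p := analyticAt_of_sub_comp_eq hNp hsmall htend hka hHk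
  have hfin : (fun ζ => x ζ t) =ᶠ[𝓝 p] fun ζ =>
      ContinuousMap.evalCLM ℝ (⟨t, ht⟩ : Icc 0 T) (h ζ) + c := by
    filter_upwards [happly] with ζ h1
    rw [ContinuousMap.evalCLM_apply, h1]
    simp [projIcc_right]
  refine AnalyticAt.congr ?_ hfin.symm
  exact (((ContinuousMap.evalCLM ℝ (⟨t, ht⟩ : Icc 0 T)).analyticAt _).comp hha).add
    analyticAt_const

/-- **Analytic dependence on parameters**: a uniformly convergent family of solutions of an analytic
differential equation, whose initial value is an analytic function of the parameter, depends
analytically on the parameter at all times. -/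
theorem analyticAt_solution [CompleteSpace E] {F : ℝ → E → E} {T : ℝ}
    (hT : 0 ≤ T) {x : G → ℝ → E} {p : G}
    (hode : ∀ᶠ ζ in 𝓝 p, ∀ t ∈ Icc 0 T, HasDerivWithinAt (x ζ) (F t (x ζ t)) (Icc 0 T) t)
    (hunif : TendstoUniformlyOn x (x p) (𝓝 p) (Icc 0 T))
    (hF : ∀ t ∈ Icc 0 T, UniformlyAnalyticAt F (x p t))
    (h0 : AnalyticAt ℝ (fun ζ => x ζ 0) p) :
    AnalyticAt ℝ (fun ζ => x ζ T) p := by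
  choose! δ hδ hstep using fun r (hr : r ∈ Icc 0 T) =>
    (hF r hr).exists_analyticAt_step hT hode hunif hr
  -- A subdivision of `[0, T]` each of whose pieces lies within `δ r` of a single `r`; analyticity
  -- then propagates from node to node.
  obtain ⟨t, ht0, htm, ⟨m, hm⟩, hsub⟩ := exists_monotone_Icc_subset_open_cover_Icc hT
    (c := fun r : Icc 0 T => {u : Icc 0 T | |(u : ℝ) - r| < δ r})
    (fun r => isOpen_lt (by fun_prop) continuous_const)
    (fun r _ => mem_iUnion.2 ⟨r, by simpa using hδ r r.2⟩)
  have hind : ∀ k, AnalyticAt ℝ (fun ζ => x ζ (t k)) p := by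
    intro k
    induction k with
    | zero => rw [ht0]; exact h0
    | succ k ih =>
      obtain ⟨r, hr⟩ := hsub k
      exact hstep r r.2 _ (t k).2 _ (t (k + 1)).2 (htm k.le_succ)
        (hr ⟨le_rfl, htm k.le_succ⟩) (hr ⟨htm k.le_succ, le_rfl⟩) ih
  have := hind m
  rwa [hm m le_rfl] at this

end AnalyticDependence

/-! ### From power series in several variables to uniformly analytic fields. -/

section UniformlyAnalytic

variable {E : Type*} [NormedAddCommGroup E] [NormedSpace ℝ E]

theorem UniformlyAnalyticAt.of_analyticAt {f : E → E} {c : E} (hf : AnalyticAt ℝ f c) :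
    UniformlyAnalyticAt (fun _ => f) c := by
  obtain ⟨p, r, hp⟩ := hf
  obtain ⟨ρ, hρ0, hρr⟩ := ENNReal.lt_iff_exists_nnreal_btwn.1 hp.r_pos
  obtain ⟨C, -, hC⟩ := p.norm_mul_pow_le_of_lt_radius (hρr.trans_le hp.r_le)
  refine ⟨ρ, by simpa using hρ0, C, fun _ => p, fun k => continuous_const, fun _ k => hC k,
    fun _ y hy => hp.hasSum ?_⟩
  rw [Metric.mem_eball, edist_zero_right]
  refine lt_trans ?_ hρr
  rw [enorm_eq_nnnorm]
  exact_mod_cast hy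

theorem UniformlyAnalyticAt.add {F G : ℝ → E → E} {c : E} (hF : UniformlyAnalyticAt F c)
    (hG : UniformlyAnalyticAt G c) : UniformlyAnalyticAt (fun t y => F t y + G t y) c := by
  obtain ⟨ρ, hρ, C, p, h1, h2, h3⟩ := hF
  obtain ⟨σ, hσ, D, q, k1, k2, k3⟩ := hG
  have hm : 0 < min ρ σ := lt_min hρ hσ
  refine ⟨min ρ σ, hm, C + D, fun t => p t + q t, fun k => (h1 k).add (k1 k), fun t k => ?_,
    fun t y hy => ?_⟩
  · calc ‖p t k + q t k‖ * min ρ σ ^ k ≤ (‖p t k‖ + ‖q t k‖) * min ρ σ ^ k := by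
          gcongr; exact norm_add_le _ _
      _ = ‖p t k‖ * min ρ σ ^ k + ‖q t k‖ * min ρ σ ^ k := add_mul _ _ _
      _ ≤ ‖p t k‖ * ρ ^ k + ‖q t k‖ * σ ^ k := by
          gcongr
          · exact min_le_left _ _
          · exact min_le_right _ _
      _ ≤ C + D := add_le_add (h2 t k) (k2 t k)
  · exact (h3 t y (hy.trans_le (min_le_left _ _))).add (k3 t y (hy.trans_le (min_le_right _ _)))

theorem UniformlyAnalyticAt.const_smul {F : ℝ → E → E} {c : E} (hF : UniformlyAnalyticAt F c)
    (a : ℝ) : UniformlyAnalyticAt (fun t y => a • F t y) c := by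
  obtain ⟨ρ, hρ, C, p, h1, h2, h3⟩ := hF
  refine ⟨ρ, hρ, |a| * C, fun t => a • p t, fun k => (h1 k).const_smul a, fun t k => ?_,
    fun t y hy => (h3 t y hy).const_smul a⟩
  have h4 : ‖(a • p t) k‖ = |a| * ‖p t k‖ := by
    change ‖a • p t k‖ = _
    rw [norm_smul, Real.norm_eq_abs]
  rw [h4, mul_assoc]
  gcongr
  exact h2 t k

/-- The monomial `∏ yᵢ ^ αᵢ` of degree `k` is the diagonal of a `k`-linear form of norm at most
one. -/
theorem exists_multilinear_monomial {n k : ℕ} (α : Fin n → ℕ) (hα : ∑ i, α i = k) :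
    ∃ m : ContinuousMultilinearMap ℝ (fun _ : Fin k => EuclideanSpace ℝ (Fin n)) ℝ,
      ‖m‖ ≤ 1 ∧ ∀ y, (m fun _ => y) = ∏ i, y i ^ α i := by
  subst hα
  -- The list of factors of the monomial: the index `i` occurs `α i` times.
  let w : Fin (∑ i, α i) → Fin n := fun j => (finSigmaFinEquiv.symm j).1
  refine ⟨(ContinuousMultilinearMap.mkPiAlgebraFin ℝ _ ℝ).compContinuousLinearMap
    fun j => EuclideanSpace.proj (w j), ?_, fun y => ?_⟩
  · refine ContinuousMultilinearMap.opNorm_le_bound zero_le_one fun h => ?_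
    simp only [ContinuousMultilinearMap.compContinuousLinearMap_apply,
      ContinuousMultilinearMap.mkPiAlgebraFin_apply, List.prod_ofFn, one_mul, norm_prod]
    gcongr with j
    exact PiLp.norm_apply_le (h j) (w j)
  · simp only [ContinuousMultilinearMap.compContinuousLinearMap_apply,
      ContinuousMultilinearMap.mkPiAlgebraFin_apply, List.prod_ofFn, EuclideanSpace.coe_proj]
    rw [← finSigmaFinEquiv.prod_comp]
    simp [w, Fintype.prod_sigma]

/-- There are at most `(k + 1) ^ n` multi-indices of degree `k`, and a geometric factor beats a
polynomial. This pays for gathering monomials by degree at the cost of halving the radius. -/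
theorem exists_card_piAntidiag_le (n : ℕ) : ∃ D : ℝ, 0 ≤ D ∧ ∀ k : ℕ,
    (Finset.piAntidiag (Finset.univ : Finset (Fin n)) k).card * (1 / 2 : ℝ) ^ k ≤ D := by
  have h1 := (tendsto_pow_const_mul_const_pow_of_abs_lt_one n
    (r := (1 / 2 : ℝ)) (by norm_num [abs_of_pos])).bddAbove_range
  obtain ⟨D, hD⟩ := h1
  have hD' : ∀ k : ℕ, (k : ℝ) ^ n * (1 / 2) ^ k ≤ D := fun k => hD ⟨k, rfl⟩
  have hD0 : 0 ≤ D := (by positivity : (0:ℝ) ≤ ((0:ℕ) : ℝ) ^ n * (1 / 2) ^ 0).trans (hD' 0)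
  refine ⟨2 * D, by positivity, fun k => ?_⟩
  have hcard : (Finset.piAntidiag (Finset.univ : Finset (Fin n)) k).card ≤ (k + 1) ^ n := by
    have hsub : Finset.piAntidiag (Finset.univ : Finset (Fin n)) k ⊆
        Fintype.piFinset fun _ => Finset.range (k + 1) := by
      intro α hα
      rw [Finset.mem_piAntidiag] at hα
      rw [Fintype.mem_piFinset]
      intro i
      rw [Finset.mem_range, Nat.lt_succ_iff, ← hα.1]
      exact Finset.single_le_sum (fun _ _ => Nat.zero_le _) (Finset.mem_univ i)
    simpa using Finset.card_le_card hsub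
  have h2 := hD' (k + 1)
  calc (Finset.piAntidiag (Finset.univ : Finset (Fin n)) k).card * (1 / 2 : ℝ) ^ k
      ≤ ((k + 1 : ℕ) : ℝ) ^ n * (1 / 2 : ℝ) ^ k := by gcongr; exact_mod_cast hcard
    _ = 2 * (((k + 1 : ℕ) : ℝ) ^ n * (1 / 2 : ℝ) ^ (k + 1)) := by rw [pow_succ]; ring
    _ ≤ 2 * D := by gcongr

/-- A field that is the sum, uniformly in time, of a multivariate power series with continuous
periodic coefficients is uniformly analytic. -/
theorem UniformlyAnalyticAt.of_monomial_series {n : ℕ} {T : ℝ} (hT : T ≠ 0)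
    {G : ℝ → EuclideanSpace ℝ (Fin n) → EuclideanSpace ℝ (Fin n)} {c : EuclideanSpace ℝ (Fin n)}
    {r : ℝ} (hr : 0 < r) {a : (Fin n → ℕ) → ℝ → EuclideanSpace ℝ (Fin n)}
    (hac : ∀ α, Continuous (a α)) (hap : ∀ α, Function.Periodic (a α) T)
    (hsum : ∀ x ∈ ball c r, TendstoUniformly
      (fun (S : Finset (Fin n → ℕ)) t => ∑ α ∈ S, (∏ i, (x i - c i) ^ α i) • a α t)
      (fun t => G t x) atTop) :
    UniformlyAnalyticAt G c := by
  -- With this `ρ` the point `c + (ρ, …, ρ)`, at distance `√n * ρ` from `c`, lies in the ball; there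
  -- each monomial takes the value `ρ ^ |α|`.
  obtain ⟨ρ, hρ⟩ : ∃ ρ : ℝ, ρ = r / (n + 1) := ⟨_, rfl⟩
  have hρ0 : 0 < ρ := by rw [hρ]; positivity
  have hρr : ρ ≤ r :=
    hρ.trans_le (div_le_self hr.le (by linarith [(Nat.cast_nonneg n : (0:ℝ) ≤ n)]))
  obtain ⟨C, hC0, hC⟩ : ∃ C : ℝ, 0 ≤ C ∧ ∀ α t, ‖a α t‖ * ρ ^ (∑ i, α i) ≤ C := by
    let x : EuclideanSpace ℝ (Fin n) := c + WithLp.toLp 2 fun _ => ρ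
    have hx : x ∈ ball c r := by
      rw [mem_ball_iff_norm, add_sub_cancel_left, EuclideanSpace.norm_eq]
      have hn : (0:ℝ) ≤ n := Nat.cast_nonneg n
      have h1 : r = ρ * (n + 1) := by rw [hρ]; field_simp
      rw [Real.sqrt_lt' hr, h1]
      simp only [Real.norm_eq_abs, sq_abs, Finset.sum_const, Finset.card_univ, Fintype.card_fin,
        nsmul_eq_mul, mul_pow]
      nlinarith [mul_nonneg hn hn, mul_pos hρ0 hρ0, mul_nonneg (mul_pos hρ0 hρ0).le hn,
        mul_nonneg (mul_pos hρ0 hρ0).le (mul_nonneg hn hn)]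
    have hpow : ∀ α : Fin n → ℕ, ∏ i, (x i - c i) ^ α i = ρ ^ (∑ i, α i) := by
      intro α
      rw [← Finset.prod_pow_eq_pow_sum]
      simp [x]
    -- Partial sums beyond `S` are within `1` of the limit, so adding a single new term changes them
    -- by at most `2`. The finitely many terms in `S` are bounded by periodicity.
    have h1 := Metric.tendstoUniformly_iff.1 (hsum x hx) 1 one_pos
    obtain ⟨S, hS⟩ := eventually_atTop.1 h1
    have hbdd : ∀ α, ∃ B, 0 ≤ B ∧ ∀ t, ‖a α t‖ * ρ ^ (∑ i, α i) ≤ B := by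
      intro α
      obtain ⟨B, hB⟩ := isBounded_iff_forall_norm_le.1
        ((hap α).isBounded_of_continuous hT (hac α))
      exact ⟨|B| * ρ ^ (∑ i, α i), by positivity, fun t => by
        gcongr; exact (hB _ ⟨t, rfl⟩).trans (le_abs_self B)⟩
    choose B hB0 hB using hbdd
    have hsB : 0 ≤ ∑ α ∈ S, B α := Finset.sum_nonneg fun α _ => hB0 α
    refine ⟨2 + ∑ α ∈ S, B α, by positivity, fun α t => ?_⟩
    by_cases hα : α ∈ S
    · have h2 := Finset.single_le_sum (fun β _ => hB0 β) hα
      linarith [hB α t]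
    · classical
      have h2 := hS S le_rfl t
      have h3 := hS (insert α S) (Finset.subset_insert _ _) t
      rw [Finset.sum_insert hα] at h3
      have h4 := dist_triangle_left
        ((∏ i, (x i - c i) ^ α i) • a α t + ∑ β ∈ S, (∏ i, (x i - c i) ^ β i) • a β t)
        (∑ β ∈ S, (∏ i, (x i - c i) ^ β i) • a β t) (G t x)
      rw [hpow] at h3
      rw [dist_eq_norm, add_sub_cancel_right, hpow, norm_smul, Real.norm_eq_abs,
        abs_of_nonneg (by positivity), mul_comm] at h4
      linarith
  obtain ⟨D, hD0, hD⟩ := exists_card_piAntidiag_le n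
  choose! m hm1 hm2 using fun (k : ℕ) (α : Fin n → ℕ) (h : ∑ i, α i = k) =>
    exists_multilinear_monomial α h
  have hmem : ∀ {k : ℕ} {α : Fin n → ℕ},
      α ∈ Finset.piAntidiag (Finset.univ : Finset (Fin n)) k → ∑ i, α i = k :=
    fun h => (Finset.mem_piAntidiag.1 h).1
  let p : ℝ → FormalMultilinearSeries ℝ (EuclideanSpace ℝ (Fin n)) (EuclideanSpace ℝ (Fin n)) :=
    fun t k => ∑ α ∈ Finset.piAntidiag Finset.univ k, (m k α).smulRight (a α t)
  refine ⟨ρ / 2, by positivity, D * C, p, fun k => ?_, fun t k => ?_, fun t y hy => ?_⟩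
  · refine continuous_finsetSum _ fun α _ => ?_
    have h1 : Continuous fun z : EuclideanSpace ℝ (Fin n) => (m k α).smulRight z :=
      (ContinuousMultilinearMap.smulRightL ℝ _ _ (m k α)).continuous
    exact h1.comp (hac α)
  · have h1 : ‖p t k‖ ≤ (Finset.piAntidiag (Finset.univ : Finset (Fin n)) k).card * (C / ρ ^ k) := by
      rw [← nsmul_eq_mul]
      refine norm_sum_le_of_le _ (fun α hα => ?_) |>.trans (Finset.sum_const _).le
      rw [ContinuousMultilinearMap.norm_smulRight, le_div_iff₀ (by positivity)]
      have h2 := hC α t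
      rw [hmem hα] at h2
      refine le_trans ?_ h2
      gcongr
      exact mul_le_of_le_one_left (norm_nonneg _) (hm1 k α (hmem hα))
    calc ‖p t k‖ * (ρ / 2) ^ k
        ≤ (Finset.piAntidiag (Finset.univ : Finset (Fin n)) k).card * (C / ρ ^ k) * (ρ / 2) ^ k := by
          gcongr
      _ = (Finset.piAntidiag (Finset.univ : Finset (Fin n)) k).card * (1 / 2 : ℝ) ^ k * C := by
          rw [div_eq_mul_one_div ρ 2, mul_pow]; field_simp [hρ0.ne']
      _ ≤ D * C := by gcongr; exact hD k
  · have hx : c + y ∈ ball c r := by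
      rw [mem_ball_iff_norm, add_sub_cancel_left]
      linarith
    have h1 : HasSum (fun α : Fin n → ℕ => (∏ i, y i ^ α i) • a α t) (G t (c + y)) := by
      have h0 : Tendsto (fun S : Finset (Fin n → ℕ) =>
          ∑ α ∈ S, (∏ i, ((c + y) i - c i) ^ α i) • a α t) atTop (𝓝 (G t (c + y))) :=
        (hsum _ hx).tendsto_at t
      simpa only [HasSum, SummationFilter.unconditional_filter, PiLp.add_apply,
        add_sub_cancel_left] using h0
    have h2 := h1.tsum_fiberwise fun α => ∑ i, α i
    convert h2 using 2 with k
    have h3 : (fun α : Fin n → ℕ => ∑ i, α i) ⁻¹' {k} =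
        ↑(Finset.piAntidiag (Finset.univ : Finset (Fin n)) k) := by
      ext α; simp
    have h4 : ∀ (A : Set (Fin n → ℕ)), A = ↑(Finset.piAntidiag (Finset.univ : Finset (Fin n)) k) →
        ∑' b : A, (∏ i, y i ^ b.1 i) • a b.1 t =
          ∑ α ∈ Finset.piAntidiag Finset.univ k, (∏ i, y i ^ α i) • a α t := by
      rintro A rfl
      exact Finset.tsum_subtype' _ fun α => (∏ i, y i ^ α i) • a α t
    rw [h4 _ h3]
    refine (sum_apply _ _ _).trans (Finset.sum_congr rfl fun α hα => ?_)
    rw [ContinuousMultilinearMap.smulRight_apply, hm2 k α (hmem hα)]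

end UniformlyAnalytic

/-- The series of `f` does not depend on time, and that of `g` with `ε` frozen converges uniformly
in time. -/
theorem IsAdmissiblePerturbation.uniformlyAnalyticAt {n : ℕ} {Ω : Set (EuclideanSpace ℝ (Fin n))}
    {f : EuclideanSpace ℝ (Fin n) → EuclideanSpace ℝ (Fin n)} (hf : AnalyticOnNhd ℝ f Ω)
    {T εs : ℝ} (hT : T ≠ 0) {g : ℝ → EuclideanSpace ℝ (Fin n) → ℝ → EuclideanSpace ℝ (Fin n)}
    (hg : IsAdmissiblePerturbation Ω T εs g) {ε : ℝ} (hε : ε ∈ Icc 0 εs)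
    {c : EuclideanSpace ℝ (Fin n)} (hc : c ∈ Ω) :
    UniformlyAnalyticAt (perturbedField f g ε) c := by
  obtain ⟨r, hr, -, a, ha, hsum⟩ := hg.analytic c hc
  have hG : UniformlyAnalyticAt (fun t x => g t x ε) c := by
    refine UniformlyAnalyticAt.of_monomial_series hT hr (a := fun α t => a α t ε)
      (fun α => (ha α ε hε).1) (fun α => (ha α ε hε).2) fun x hx => ?_
    rw [Metric.tendstoUniformly_iff]
    intro δ hδ
    filter_upwards [Metric.tendstoUniformlyOn_iff.1 (hsum x hx) δ hδ] with S hS t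
    exact hS (t, ε) ⟨mem_univ _, hε⟩
  exact (UniformlyAnalyticAt.of_analyticAt (hf c hc)).add (hG.const_smul ε)

/-- Grönwall's inequality on `[0, T]` in a form free of exponential integrals. -/
theorem norm_le_exp_mul_of_norm_deriv_le {E : Type*} [NormedAddCommGroup E] [NormedSpace ℝ E]
    {u u' : ℝ → E} {K b T : ℝ} (hK : 1 ≤ K) (hb : 0 ≤ b)
    (hu : ∀ t ∈ Icc 0 T, HasDerivWithinAt u (u' t) (Icc 0 T) t)
    (hbound : ∀ t ∈ Ico 0 T, ‖u' t‖ ≤ K * ‖u t‖ + b) :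
    ∀ t ∈ Icc 0 T, ‖u t‖ ≤ Real.exp (K * T) * (‖u 0‖ + b) := by
  intro t ht
  have hK0 : 0 < K := by linarith
  have h1 := norm_le_gronwallBound_of_norm_deriv_right_le (f := u) (f' := u') (δ := ‖u 0‖)
    (fun t ht => (hu t ht).continuousWithinAt)
    (fun t ht => (hu t (Ico_subset_Icc_self ht)).mono_of_mem_nhdsWithin
      (Icc_mem_nhdsGE_of_mem ht)) le_rfl hbound t ht
  rw [gronwallBound_of_K_ne_0 hK0.ne', sub_zero] at h1
  have h2 : Real.exp (K * t) ≤ Real.exp (K * T) := by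
    gcongr; exact ht.2
  have h3 : b / K ≤ b := div_le_self hb hK
  have h4 : 1 ≤ Real.exp (K * t) := Real.one_le_exp (mul_nonneg hK0.le ht.1)
  calc ‖u t‖ ≤ ‖u 0‖ * Real.exp (K * t) + b / K * (Real.exp (K * t) - 1) := h1
    _ ≤ ‖u 0‖ * Real.exp (K * T) + b * Real.exp (K * T) := by
      gcongr
      linarith
    _ = Real.exp (K * T) * (‖u 0‖ + b) := by ring

/-! ### The variational equation and its monodromy operator. -/

section Linear

variable {n : ℕ}

/-- Solutions of a linear equation with bounded coefficients are determined by one value. -/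
theorem eq_of_hasDerivAt_linear {A : ℝ → EuclideanSpace ℝ (Fin n) →L[ℝ] EuclideanSpace ℝ (Fin n)} {K : ℝ} (hK : ∀ t, ‖A t‖ ≤ K)
    {u w : ℝ → EuclideanSpace ℝ (Fin n)} (hu : ∀ t, HasDerivAt u (A t (u t)) t) (hw : ∀ t, HasDerivAt w (A t (w t)) t)
    {t₀ : ℝ} (h : u t₀ = w t₀) : u = w := by
  refine ODE_solution_unique_univ (v := fun t x => A t x) (s := fun _ => univ) (K := K.toNNReal)
    (t₀ := t₀) (fun t => ?_) (fun t => ⟨hu t, mem_univ _⟩) (fun t => ⟨hw t, mem_univ _⟩) h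
  refine ((A t).lipschitz.weaken ?_).lipschitzOnWith
  rw [← NNReal.coe_le_coe, coe_nnnorm]
  exact (hK t).trans (Real.le_coe_toNNReal K)

/-- If `1` is a simple root of the characteristic polynomial, its eigenspace is a line. -/
theorem exists_smul_of_isFixedPt_of_aroots {B : EuclideanSpace ℝ (Fin n) →L[ℝ] EuclideanSpace ℝ (Fin n)} {s : Multiset ℂ}
    (hB : 1 ::ₘ s = B.toLinearMap.charpoly.aroots ℂ) (hs : ∀ μ ∈ s, ‖μ‖ < 1)
    {v w : EuclideanSpace ℝ (Fin n)} (hv0 : v ≠ 0) (hv : B v = v) (hw : B w = w) : ∃ c : ℝ, w = c • v := by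
  -- The other roots have modulus below one, so `1` is simple over `ℂ`, hence over `ℝ`; the
  -- geometric multiplicity cannot exceed the algebraic one.
  have hmult : B.toLinearMap.charpoly.rootMultiplicity 1 = 1 := by
    rw [Polynomial.eq_rootMultiplicity_map (algebraMap ℝ ℂ).injective, map_one,
      ← Polynomial.count_roots, ← Polynomial.aroots_def, ← hB, Multiset.count_cons_self,
      Multiset.count_eq_zero.2]
    intro h
    simpa using hs 1 h
  have hfin := LinearMap.finrank_eigenspace_le B.toLinearMap 1
  rw [hmult] at hfin
  have hmem : ∀ u, B u = u → u ∈ Module.End.eigenspace B.toLinearMap 1 := fun u hu => by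
    rw [Module.End.mem_eigenspace_iff, one_smul]; exact hu
  obtain ⟨e, he⟩ := finrank_le_one_iff.1 hfin
  obtain ⟨a, ha⟩ := he ⟨v, hmem v hv⟩
  obtain ⟨b, hb⟩ := he ⟨w, hmem w hw⟩
  have ha' : a • (e : EuclideanSpace ℝ (Fin n)) = v := congrArg Subtype.val ha
  have hb' : b • (e : EuclideanSpace ℝ (Fin n)) = w := congrArg Subtype.val hb
  have ha0 : a ≠ 0 := by
    rintro rfl
    exact hv0 (by rw [← ha', zero_smul])
  exact ⟨b / a, by rw [← ha', ← hb', smul_smul, div_mul_cancel₀ _ ha0]⟩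

variable {Ω : Set (EuclideanSpace ℝ (Fin n))} {f : EuclideanSpace ℝ (Fin n) → EuclideanSpace ℝ (Fin n)} {T : ℝ} {x₀ z₀ : ℝ → EuclideanSpace ℝ (Fin n)}

theorem IsNonconstantPeriodicSolution.continuous (hx₀ : IsNonconstantPeriodicSolution Ω f T x₀) :
    Continuous x₀ := continuous_iff_continuousAt.2 fun t => (hx₀.ode t).continuousAt

theorem IsNonconstantPeriodicSolution.isCompact_range
    (hx₀ : IsNonconstantPeriodicSolution Ω f T x₀) (hT : T ≠ 0) : IsCompact (range x₀) :=
  hx₀.periodic.compact_of_continuous hT hx₀.continuous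

theorem IsNonconstantPeriodicSolution.exists_norm_fderiv_le
    (hx₀ : IsNonconstantPeriodicSolution Ω f T x₀) (hf : AnalyticOnNhd ℝ f Ω) (hT : T ≠ 0) :
    ∃ K, ∀ t, ‖fderiv ℝ f (x₀ t)‖ ≤ K := by
  have h1 : ContinuousOn (fderiv ℝ f) (range x₀) :=
    hf.fderiv.continuousOn.mono (range_subset_iff.2 hx₀.mem)
  obtain ⟨K, hK⟩ := (hx₀.isCompact_range hT).exists_bound_of_continuousOn h1
  exact ⟨K, fun t => hK _ ⟨t, rfl⟩⟩

/-- Differentiating `x' = f(x)` along the orbit shows that its velocity solves the variational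
equation; this is the source of the multiplier `1`. -/
theorem IsNonconstantPeriodicSolution.hasDerivAt_velocity
    (hx₀ : IsNonconstantPeriodicSolution Ω f T x₀) (hf : AnalyticOnNhd ℝ f Ω) (t : ℝ) :
    HasDerivAt (fun s => f (x₀ s)) (fderiv ℝ f (x₀ t) (f (x₀ t))) t :=
  ((hf _ (hx₀.mem t)).differentiableAt.hasFDerivAt).comp_hasDerivAt t (hx₀.ode t)

theorem IsNormalizedAdjointSolution.inner_velocity (hz₀ : IsNormalizedAdjointSolution f T x₀ z₀)
    (hx₀ : IsNonconstantPeriodicSolution Ω f T x₀) (t : ℝ) : inner ℝ (f (x₀ t)) (z₀ t) = 1 := by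
  rw [← (hx₀.ode t).deriv]; exact hz₀.normalized t

/-- The principal solution `Z` of the variational equation along `t ↦ x₀ (t + θ)`: the fixed vectors
of `Z T` are the multiples of the velocity, and `z₀ θ` is a left eigenvector. -/
theorem exists_shifted_monodromy (hf : AnalyticOnNhd ℝ f Ω) (hT : 0 < T)
    (hx₀ : IsNonconstantPeriodicSolution Ω f T x₀) (hfloquet : FloquetCondition f T x₀)
    (hz₀ : IsNormalizedAdjointSolution f T x₀ z₀) (θ : ℝ) :
    ∃ Z : ℝ → EuclideanSpace ℝ (Fin n) →L[ℝ] EuclideanSpace ℝ (Fin n), Z 0 = ContinuousLinearMap.id ℝ (EuclideanSpace ℝ (Fin n)) ∧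
      (∀ t, HasDerivAt Z ((fderiv ℝ f (x₀ (t + θ))).comp (Z t)) t) ∧
      (∀ w, Z T w = w → ∃ c : ℝ, w = c • f (x₀ θ)) ∧
      ∀ w, inner ℝ (Z T w) (z₀ θ) = (inner ℝ w (z₀ θ) : ℝ) := by
  obtain ⟨s, ⟨Y, ⟨hY0, hY⟩, hs⟩, hs1⟩ := hfloquet
  obtain ⟨K, hK⟩ := hx₀.exists_norm_fderiv_le hf hT.ne'
  have hYw : ∀ w t, HasDerivAt (fun t => Y t w) (fderiv ℝ f (x₀ t) (Y t w)) t := fun w t =>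
    (hY t).clm_apply (hasDerivAt_const t w) |>.congr_deriv (by simp)
  have hv : ∀ t, Y t (f (x₀ 0)) = f (x₀ t) := fun t => congrFun
    (eq_of_hasDerivAt_linear hK (hYw (f (x₀ 0))) (hx₀.hasDerivAt_velocity hf) (t₀ := 0)
      (by simp [hY0])) t
  have hinj : Function.Injective (Y θ).toLinearMap := by
    intro u w huw
    have := congrFun (eq_of_hasDerivAt_linear hK (hYw u) (hYw w) (t₀ := θ) huw) 0
    simpa [hY0] using this
  let e := (LinearEquiv.ofInjectiveEndo _ hinj).toContinuousLinearEquiv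
  have he : ∀ w, Y θ (e.symm w) = w := fun w => e.apply_symm_apply w
  -- By periodicity of the coefficients. Hence the operator `Y (T + θ) ∘ (Y θ)⁻¹` is conjugate to `Y
  -- T`, and fixed vectors can be carried from one to the other.
  have hshift : ∀ u t, Y (t + T) u = Y t (Y T u) := by
    intro u t
    refine congrFun (eq_of_hasDerivAt_linear (u := fun t => Y (t + T) u) hK (fun t => ?_)
      (hYw (Y T u)) (t₀ := 0) (by simp [hY0])) t
    have h1 := (hYw u (t + T)).comp_add_const t T
    rwa [hx₀.periodic t] at h1
  refine ⟨fun t => (Y (t + θ)).comp (e.symm : EuclideanSpace ℝ (Fin n) →L[ℝ] EuclideanSpace ℝ (Fin n)), ?_, fun t => ?_, fun w hw => ?_,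
    fun w => ?_⟩
  · ext1 w
    simp [he]
  · have h1 := (hY (t + θ)).comp_add_const t θ
    exact (h1.clm_comp (hasDerivAt_const t (e.symm : EuclideanSpace ℝ (Fin n) →L[ℝ] EuclideanSpace ℝ (Fin n)))).congr_deriv (by
      simp [ContinuousLinearMap.comp_assoc])
  · have h1 : Y θ (Y T (e.symm w)) = Y θ (e.symm w) := by
      rw [← hshift, he, add_comm]; exact hw
    have h2 : Y T (e.symm w) = e.symm w := hinj h1
    have hv0 : f (x₀ 0) ≠ 0 := by
      intro h
      have := hz₀.inner_velocity hx₀ 0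
      rw [h, inner_zero_left] at this
      exact zero_ne_one this
    have hvT : Y T (f (x₀ 0)) = f (x₀ 0) := by
      rw [hv, ← hx₀.periodic 0, zero_add]
    obtain ⟨c, hc⟩ := exists_smul_of_isFixedPt_of_aroots hs hs1 hv0 hvT h2
    exact ⟨c, by rw [← hv, ← map_smul, ← hc, he]⟩
  -- The pairing of a variational solution with an adjoint solution is constant in time.
  · have hconst : ∀ t, HasDerivAt (fun t => (inner ℝ (Y t (e.symm w)) (z₀ t) : ℝ)) 0 t := by
      intro t
      refine ((hYw (e.symm w) t).inner ℝ (hz₀.ode t)).congr_deriv ?_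
      rw [inner_neg_right, ContinuousLinearMap.adjoint_inner_right]
      ring
    have h1 := is_const_of_deriv_eq_zero (fun t => (hconst t).differentiableAt)
      (fun t => (hconst t).deriv) (T + θ) θ
    have h2 : z₀ (T + θ) = z₀ θ := by rw [add_comm]; exact hz₀.periodic θ
    rw [h2, he] at h1
    exact h1

end Linear

/-! ### Uniform estimates in a tube around the orbit. -/

section Tube

variable {n : ℕ} {Ω : Set (EuclideanSpace ℝ (Fin n))}
  {f : EuclideanSpace ℝ (Fin n) → EuclideanSpace ℝ (Fin n)} {T εs : ℝ}
  {x₀ z₀ : ℝ → EuclideanSpace ℝ (Fin n)}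
  {g : ℝ → EuclideanSpace ℝ (Fin n) → ℝ → EuclideanSpace ℝ (Fin n)}

/-- The orbit is compact, so some closed thickening of it stays in `Ω`. All constants below are
taken on this set and so do not depend on the phase `τ`. -/
theorem IsNonconstantPeriodicSolution.exists_isCompact_tube (hΩ : IsOpen Ω)
    (hx₀ : IsNonconstantPeriodicSolution Ω f T x₀) (hT : T ≠ 0) :
    ∃ δ > 0, ∃ S ⊆ Ω, IsCompact S ∧ ∀ τ, closedBall (x₀ τ) δ ⊆ S := by
  obtain ⟨δ, hδ, hsub⟩ := (hx₀.isCompact_range hT).exists_cthickening_subset_open hΩ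
    (range_subset_iff.2 hx₀.mem)
  exact ⟨δ, hδ, _, hsub, (hx₀.isCompact_range hT).cthickening, fun τ =>
    closedBall_subset_cthickening (mem_range_self τ) δ⟩

/-- The field `f` is strictly differentiable along the orbit, uniformly in time. -/
theorem IsNonconstantPeriodicSolution.exists_approximatesLinear (hΩ : IsOpen Ω)
    (hf : AnalyticOnNhd ℝ f Ω) (hx₀ : IsNonconstantPeriodicSolution Ω f T x₀) (hT : T ≠ 0)
    {η : ℝ} (hη : 0 < η) :
    ∃ ρ > 0, ∀ τ, ∀ y ∈ closedBall (x₀ τ) ρ, ∀ y' ∈ closedBall (x₀ τ) ρ,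
      ‖f y - f y' - fderiv ℝ f (x₀ τ) (y - y')‖ ≤ η * ‖y - y'‖ := by
  obtain ⟨δ, hδ, S, hSΩ, hS, hball⟩ := hx₀.exists_isCompact_tube hΩ hT
  have huc := hS.uniformContinuousOn_of_continuous (hf.fderiv.continuousOn.mono hSΩ)
  obtain ⟨δ', hδ', huc⟩ := Metric.uniformContinuousOn_iff_le.1 huc η hη
  refine ⟨min δ δ', lt_min hδ hδ', fun τ y hy y' hy' => ?_⟩
  have hsub : closedBall (x₀ τ) (min δ δ') ⊆ S :=
    (closedBall_subset_closedBall (min_le_left _ _)).trans (hball τ)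
  refine (convex_closedBall (x₀ τ) (min δ δ')).norm_image_sub_le_of_norm_hasFDerivWithin_le'
    (f' := fderiv ℝ f) (fun u hu => ?_) (fun u hu => ?_) hy' hy
  · exact (hf u (hSΩ (hsub hu))).differentiableAt.hasFDerivAt.hasFDerivWithinAt
  · rw [← dist_eq_norm]
    refine huc u (hsub hu) _ (hball τ (mem_closedBall_self hδ.le)) ?_
    exact (mem_closedBall.1 hu).trans (min_le_right _ _)

/-- The perturbation is bounded and Lipschitz in `(x, ε)` near the orbit, uniformly in time. -/
theorem IsAdmissiblePerturbation.exists_lipschitz (hΩ : IsOpen Ω) (hεs : 0 < εs)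
    (hx₀ : IsNonconstantPeriodicSolution Ω f T x₀) (hT : T ≠ 0)
    (hg : IsAdmissiblePerturbation Ω T εs g) :
    ∃ ρ > 0, ∃ L : ℝ, ∀ τ, ∀ t ∈ Icc 0 T, ∀ y ∈ closedBall (x₀ τ) ρ, ∀ ε ∈ Icc 0 εs,
      ‖g t y ε‖ ≤ L ∧ ∀ y' ∈ closedBall (x₀ τ) ρ, ∀ ε' ∈ Icc 0 εs,
        ‖g t y ε - g t y' ε'‖ ≤ L * (‖y - y'‖ + |ε - ε'|) := by
  obtain ⟨δ, hδ, S, hSΩ, hS, hball⟩ := hx₀.exists_isCompact_tube hΩ hT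
  have hcomp : IsCompact (Icc 0 T ×ˢ (S ×ˢ Icc 0 εs)) := isCompact_Icc.prod (hS.prod isCompact_Icc)
  have hsub : Icc 0 T ×ˢ (S ×ˢ Icc 0 εs) ⊆ univ ×ˢ (Ω ×ˢ Icc 0 εs) :=
    prod_mono (subset_univ _) (prod_mono hSΩ Subset.rfl)
  obtain ⟨L₀, hL₀⟩ := hcomp.exists_bound_of_continuousOn (hg.continuousOn.mono hsub)
  obtain ⟨L₁, hL₁⟩ := hcomp.exists_bound_of_continuousOn
    ((hg.continuousOn_derivatives 1 (by norm_num)).mono hsub)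
  -- Since `0 < εs`, one-sided derivatives in `ε` are unique and the first iterated derivative has
  -- the norm of `fderivWithin`.
  have huniq : UniqueDiffOn ℝ (Ω ×ˢ Icc 0 εs) := hΩ.uniqueDiffOn.prod (uniqueDiffOn_Icc hεs)
  refine ⟨δ, hδ, max L₀ L₁, fun τ t ht y hy ε hε => ⟨?_, fun y' hy' ε' hε' => ?_⟩⟩
  · exact (hL₀ (t, y, ε) ⟨ht, hball τ hy, hε⟩).trans (le_max_left _ _)
  · have hsub' : closedBall (x₀ τ) δ ×ˢ Icc 0 εs ⊆ Ω ×ˢ Icc 0 εs :=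
      prod_mono ((hball τ).trans hSΩ) Subset.rfl
    have h1 := ((convex_closedBall (x₀ τ) δ).prod
      (convex_Icc 0 εs)).norm_image_sub_le_of_norm_hasFDerivWithin_le
      (f := fun p : EuclideanSpace ℝ (Fin n) × ℝ => g t p.1 p.2)
      (f' := fderivWithin ℝ (fun p : EuclideanSpace ℝ (Fin n) × ℝ => g t p.1 p.2) (Ω ×ˢ Icc 0 εs))
      (C := max L₀ L₁) (x := (y', ε')) (y := (y, ε))
      (fun p hp => (((hg.contDiffOn t).differentiableOn (by norm_num) p
        (hsub' hp)).hasFDerivWithinAt).mono hsub')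
      (fun p hp => by
        rw [← norm_iteratedFDerivWithin_one _ (huniq p (hsub' hp))]
        exact (hL₁ (t, p) ⟨ht, hball τ hp.1, hp.2⟩).trans (le_max_right _ _))
      ⟨hy', hε'⟩ ⟨hy, hε⟩
    have hL : 0 ≤ max L₀ L₁ := (norm_nonneg _).trans
      ((hL₀ (t, y, ε) ⟨ht, hball τ hy, hε⟩).trans (le_max_left _ _))
    refine h1.trans (mul_le_mul_of_nonneg_left ?_ hL)
    rw [Prod.mk_sub_mk, Prod.norm_mk, Real.norm_eq_abs]
    exact max_le (le_add_of_nonneg_right (abs_nonneg _)) (le_add_of_nonneg_left (norm_nonneg _))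

/-- Bounds for the perturbed field in the tube of radius `ρ` around the orbit. -/
structure IsTubeBound (Ω : Set (EuclideanSpace ℝ (Fin n)))
    (f : EuclideanSpace ℝ (Fin n) → EuclideanSpace ℝ (Fin n)) (T εs : ℝ)
    (x₀ : ℝ → EuclideanSpace ℝ (Fin n))
    (g : ℝ → EuclideanSpace ℝ (Fin n) → ℝ → EuclideanSpace ℝ (Fin n)) (ρ K : ℝ) : Prop where
  pos : 0 < ρ
  one_le : 1 ≤ K
  subset : ∀ τ, closedBall (x₀ τ) ρ ⊆ Ω
  fderiv_le : ∀ τ, ‖fderiv ℝ f (x₀ τ)‖ ≤ K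
  g_le : ∀ τ, ∀ t ∈ Icc 0 T, ∀ y ∈ closedBall (x₀ τ) ρ, ∀ ε ∈ Icc 0 εs, ‖g t y ε‖ ≤ K
  g_sub_le : ∀ τ, ∀ t ∈ Icc 0 T, ∀ y ∈ closedBall (x₀ τ) ρ, ∀ ε ∈ Icc 0 εs,
    ∀ y' ∈ closedBall (x₀ τ) ρ, ∀ ε' ∈ Icc 0 εs,
      ‖g t y ε - g t y' ε'‖ ≤ K * (‖y - y'‖ + |ε - ε'|)
  f_sub_le : ∀ τ, ∀ y ∈ closedBall (x₀ τ) ρ, ∀ y' ∈ closedBall (x₀ τ) ρ,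
    ‖f y - f y'‖ ≤ K * ‖y - y'‖
  field_sub_le : ∀ τ, ∀ t ∈ Icc 0 T, ∀ y ∈ closedBall (x₀ τ) ρ, ∀ y' ∈ closedBall (x₀ τ) ρ,
    ∀ ε ∈ Icc 0 εs, ‖perturbedField f g ε t y - perturbedField f g ε t y'‖ ≤ K * ‖y - y'‖

/-- In the constant, `K₀ + 1` serves `f` (derivative plus linearisation error), `|L|` serves `g`,
and `εs * |L|` is a Lipschitz constant of `ε • g`. -/
theorem exists_isTubeBound (hΩ : IsOpen Ω) (hf : AnalyticOnNhd ℝ f Ω) (hεs : 0 < εs)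
    (hx₀ : IsNonconstantPeriodicSolution Ω f T x₀) (hT : T ≠ 0)
    (hg : IsAdmissiblePerturbation Ω T εs g) : ∃ ρ K, IsTubeBound Ω f T εs x₀ g ρ K := by
  obtain ⟨δ, hδ, S, hSΩ, hS, hball⟩ := hx₀.exists_isCompact_tube hΩ hT
  obtain ⟨K₀, hK₀⟩ := hx₀.exists_norm_fderiv_le hf hT
  obtain ⟨ρ₁, hρ₁, hlin⟩ := hx₀.exists_approximatesLinear hΩ hf hT one_pos
  obtain ⟨ρ₂, hρ₂, L, hL⟩ := hg.exists_lipschitz hΩ hεs hx₀ hT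
  set ρ := min δ (min ρ₁ ρ₂) with hρ
  have hρ0 : 0 < ρ := lt_min hδ (lt_min hρ₁ hρ₂)
  have hb0 : ∀ τ, closedBall (x₀ τ) ρ ⊆ closedBall (x₀ τ) δ := fun τ =>
    closedBall_subset_closedBall (min_le_left _ _)
  have hb1 : ∀ τ, closedBall (x₀ τ) ρ ⊆ closedBall (x₀ τ) ρ₁ := fun τ =>
    closedBall_subset_closedBall ((min_le_right _ _).trans (min_le_left _ _))
  have hb2 : ∀ τ, closedBall (x₀ τ) ρ ⊆ closedBall (x₀ τ) ρ₂ := fun τ =>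
    closedBall_subset_closedBall ((min_le_right _ _).trans (min_le_right _ _))
  have hK0 : 0 ≤ K₀ := (norm_nonneg _).trans (hK₀ 0)
  have hfK : ∀ τ, ∀ y ∈ closedBall (x₀ τ) ρ, ∀ y' ∈ closedBall (x₀ τ) ρ,
      ‖f y - f y'‖ ≤ (K₀ + 1) * ‖y - y'‖ := by
    intro τ y hy y' hy'
    have h1 := hlin τ y (hb1 τ hy) y' (hb1 τ hy')
    have h2 := (fderiv ℝ f (x₀ τ)).le_of_opNorm_le (hK₀ τ) (y - y')
    have h3 := norm_le_norm_sub_add (f y - f y') (fderiv ℝ f (x₀ τ) (y - y'))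
    linarith
  have hA : 0 ≤ |L| := abs_nonneg L
  have hB : 0 ≤ εs * |L| := by positivity
  have hgK : ∀ τ, ∀ t ∈ Icc 0 T, ∀ y ∈ closedBall (x₀ τ) ρ, ∀ ε ∈ Icc 0 εs,
      ∀ y' ∈ closedBall (x₀ τ) ρ, ∀ ε' ∈ Icc 0 εs,
      ‖g t y ε - g t y' ε'‖ ≤ |L| * (‖y - y'‖ + |ε - ε'|) := by
    intro τ t ht y hy ε hε y' hy' ε' hε'
    refine ((hL τ t ht y (hb2 τ hy) ε hε).2 y' (hb2 τ hy') ε' hε').trans ?_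
    gcongr
    exact le_abs_self L
  refine ⟨ρ, K₀ + 1 + |L| + εs * |L|, hρ0, by linarith, fun τ => ((hb0 τ).trans (hball τ)).trans hSΩ,
    fun τ => (hK₀ τ).trans (by linarith), fun τ t ht y hy ε hε => ?_,
    fun τ t ht y hy ε hε y' hy' ε' hε' => ?_, fun τ y hy y' hy' => ?_,
    fun τ t ht y hy y' hy' ε hε => ?_⟩
  · have := (hL τ t ht y (hb2 τ hy) ε hε).1
    linarith [le_abs_self L]
  · refine (hgK τ t ht y hy ε hε y' hy' ε' hε').trans ?_
    gcongr
    linarith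
  · exact (hfK τ y hy y' hy').trans
      (mul_le_mul_of_nonneg_right (by linarith) (norm_nonneg _))
  · have h1 := hgK τ t ht y hy ε hε y' hy' ε hε
    have h2 := hfK τ y hy y' hy'
    rw [sub_self, abs_zero, add_zero] at h1
    have h3 : perturbedField f g ε t y - perturbedField f g ε t y' =
        (f y - f y') + ε • (g t y ε - g t y' ε) := by
      simp only [perturbedField, smul_sub]; abel
    have h4 : ‖ε • (g t y ε - g t y' ε)‖ ≤ εs * (|L| * ‖y - y'‖) := by
      rw [norm_smul, Real.norm_eq_abs, abs_of_nonneg hε.1]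
      exact mul_le_mul hε.2 h1 (norm_nonneg _) hεs.le
    rw [h3]
    refine (norm_add_le _ _).trans ?_
    nlinarith [mul_nonneg hA (norm_nonneg (y - y'))]

end Tube

/-! ### Coordinatewise truncation. -/

section Clip

variable {n : ℕ}

/-- Truncation of all coordinates to `[-a, a]`. -/
noncomputable def coordinateClip (a : ℝ) (u : EuclideanSpace ℝ (Fin n)) :
    EuclideanSpace ℝ (Fin n) :=
  WithLp.toLp 2 fun i => max (-a) (min a (u i))

/-- Clamping to an interval is nonexpansive in each coordinate. Truncation therefore turns a field
on the tube into a global one with the same Lipschitz constant. -/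
theorem norm_coordinateClip_sub_le (a : ℝ) (u w : EuclideanSpace ℝ (Fin n)) :
    ‖coordinateClip a u - coordinateClip a w‖ ≤ ‖u - w‖ := by
  rw [EuclideanSpace.norm_eq, EuclideanSpace.norm_eq]
  gcongr with i
  simp only [coordinateClip, PiLp.sub_apply, Real.norm_eq_abs]
  calc |max (-a) (min a (u i)) - max (-a) (min a (w i))| ≤ |min a (u i) - min a (w i)| := by
        simpa using abs_max_sub_max_le_max (-a) (min a (u i)) (-a) (min a (w i))
    _ ≤ |u i - w i| := by simpa using abs_min_sub_min_le_max a (u i) a (w i)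

theorem coordinateClip_eq_self {a : ℝ} {u : EuclideanSpace ℝ (Fin n)} (hu : ‖u‖ ≤ a) :
    coordinateClip a u = u := by
  ext i
  have h := abs_le.1 ((PiLp.norm_apply_le u i).trans hu)
  simp only [coordinateClip]
  rw [min_eq_right h.2, max_eq_right h.1]

theorem norm_coordinateClip_le_norm {a : ℝ} (ha : 0 ≤ a) (u : EuclideanSpace ℝ (Fin n)) :
    ‖coordinateClip a u‖ ≤ ‖u‖ := by
  have h := norm_coordinateClip_sub_le a u 0
  rwa [coordinateClip_eq_self (u := 0) (by simpa using ha), sub_zero, sub_zero] at h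

theorem norm_coordinateClip_le {a : ℝ} (ha : 0 ≤ a) (u : EuclideanSpace ℝ (Fin n)) :
    ‖coordinateClip a u‖ ≤ (n + 1) * a := by
  rw [EuclideanSpace.norm_eq]
  refine Real.sqrt_le_iff.2 ⟨by positivity, ?_⟩
  have h1 : ∀ i, ‖(coordinateClip a u) i‖ ^ 2 ≤ a ^ 2 := by
    intro i
    rw [Real.norm_eq_abs, sq_abs, sq_le_sq, abs_of_nonneg ha, abs_le]
    exact ⟨le_max_left _ _, max_le (by linarith) (min_le_left _ _)⟩
  calc ∑ i, ‖(coordinateClip a u) i‖ ^ 2 ≤ ∑ _i : Fin n, a ^ 2 := Finset.sum_le_sum fun i _ => h1 i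
    _ = n * a ^ 2 := by simp
    _ ≤ ((n + 1) * a) ^ 2 := by
      have hn : (0:ℝ) ≤ n := Nat.cast_nonneg n
      nlinarith [mul_nonneg hn (sq_nonneg a), mul_nonneg (mul_nonneg hn hn) (sq_nonneg a),
        sq_nonneg a]

end Clip

/-! ### Existence, uniqueness and size of perturbed solutions on the whole period. -/

section Flow

variable {n : ℕ} {Ω : Set (EuclideanSpace ℝ (Fin n))}
  {f : EuclideanSpace ℝ (Fin n) → EuclideanSpace ℝ (Fin n)} {T εs : ℝ}
  {x₀ z₀ : ℝ → EuclideanSpace ℝ (Fin n)}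
  {g : ℝ → EuclideanSpace ℝ (Fin n) → ℝ → EuclideanSpace ℝ (Fin n)} {ρ K : ℝ}

/-- A field which is continuous in time, globally Lipschitz in space and bounded on `[0, T]` has
solutions on the whole of `[0, T]`. -/
theorem exists_solution_of_lipschitz {E : Type*} [NormedAddCommGroup E] [NormedSpace ℝ E]
    [CompleteSpace E] {G : ℝ → E → E} {T K L : ℝ} (hT : 0 ≤ T)
    (hlip : ∀ t ∈ Icc 0 T, ∀ u w, ‖G t u - G t w‖ ≤ K * ‖u - w‖)
    (hcont : ∀ u, ContinuousOn (fun t => G t u) (Icc 0 T))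
    (hbdd : ∀ t ∈ Icc 0 T, ∀ u, ‖G t u‖ ≤ L) (u₀ : E) :
    ∃ u : ℝ → E, u 0 = u₀ ∧ ∀ t ∈ Icc 0 T, HasDerivWithinAt u (G t (u t)) (Icc 0 T) t := by
  -- A field bounded by `L` moves a point by at most `L * T`, so with this radius the time interval
  -- need not be shortened.
  have hpl : IsPicardLindelof G (tmin := 0) (tmax := T) ⟨0, left_mem_Icc.2 hT⟩ u₀
      (L.toNNReal * T.toNNReal) 0 L.toNNReal K.toNNReal :=
    { lipschitzOnWith := fun t ht => LipschitzOnWith.of_dist_le_mul fun u _ w _ => by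
        rw [dist_eq_norm, dist_eq_norm]
        refine (hlip t ht u w).trans ?_
        gcongr
        exact Real.le_coe_toNNReal K
      continuousOn := fun u _ => hcont u
      norm_le := fun t ht u _ => (hbdd t ht u).trans (Real.le_coe_toNNReal L)
      mul_max_le := by
        simp [hT] }
  exact hpl.exists_eq_forall_mem_Icc_hasDerivWithinAt₀

theorem IsTubeBound.K_pos (h : IsTubeBound Ω f T εs x₀ g ρ K) : 0 < K :=
  zero_lt_one.trans_le h.one_le

theorem IsTubeBound.center_mem (h : IsTubeBound Ω f T εs x₀ g ρ K) (τ : ℝ) :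
    x₀ τ ∈ closedBall (x₀ τ) ρ := mem_closedBall_self h.pos.le

/-- The perturbed field compared with the velocity of the orbit. -/
theorem IsTubeBound.field_sub_velocity_le (h : IsTubeBound Ω f T εs x₀ g ρ K) {τ t ε : ℝ}
    (ht : t ∈ Icc 0 T) (hε : ε ∈ Icc 0 εs) {y : EuclideanSpace ℝ (Fin n)}
    (hy : y ∈ closedBall (x₀ τ) ρ) :
    ‖perturbedField f g ε t y - f (x₀ τ)‖ ≤ K * ‖y - x₀ τ‖ + ε * K := by
  have h1 := h.field_sub_le τ t ht y hy _ (h.center_mem τ) ε hε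
  have h2 := h.g_le τ t ht _ (h.center_mem τ) ε hε
  have h3 : perturbedField f g ε t y - f (x₀ τ) =
      (perturbedField f g ε t y - perturbedField f g ε t (x₀ τ)) + ε • g t (x₀ τ) ε := by
    simp only [perturbedField]; abel
  rw [h3]
  refine (norm_add_le _ _).trans (add_le_add h1 ?_)
  rw [norm_smul, Real.norm_eq_abs, abs_of_nonneg hε.1]
  exact mul_le_mul_of_nonneg_left h2 hε.1

/-- Existence of solutions of the perturbed equation near the orbit, on the whole of `[0, T]`. -/
theorem IsTubeBound.exists_isSolutionFrom (h : IsTubeBound Ω f T εs x₀ g ρ K) (hT : 0 ≤ T)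
    (hf : ContinuousOn f Ω)
    (hx₀ : IsNonconstantPeriodicSolution Ω f T x₀) (hg : IsAdmissiblePerturbation Ω T εs g)
    {θ ε : ℝ} (hε : ε ∈ Icc 0 εs) {ζ : EuclideanSpace ℝ (Fin n)}
    (hζ : Real.exp (K * T) * (‖ζ - x₀ θ‖ + ε * K) ≤ ρ / (n + 1)) :
    ∃ x, IsSolutionFrom Ω (perturbedField f g ε) T ζ x ∧ ∀ t ∈ Icc 0 T,
      ‖x t - x₀ (t + θ)‖ ≤ Real.exp (K * T) * (‖ζ - x₀ θ‖ + ε * K) := by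
  have hK := h.K_pos
  set a := ρ / (n + 1) with ha
  have ha0 : 0 ≤ a := div_nonneg h.pos.le (by positivity)
  have hclip : ∀ u : EuclideanSpace ℝ (Fin n), ‖coordinateClip a u‖ ≤ ρ := fun u =>
    (norm_coordinateClip_le ha0 u).trans_eq (by rw [ha]; field_simp)
  have hmem : ∀ t u, x₀ (t + θ) + coordinateClip a u ∈ closedBall (x₀ (t + θ)) ρ := fun t u => by
    rw [mem_closedBall_iff_norm, add_sub_cancel_left]; exact hclip u
  -- The equation for the deviation `u` from the orbit, with `u` truncated so that the field is
  -- globally Lipschitz. Grönwall's inequality then gives `‖u‖ ≤ a`, so the truncation never acts.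
  let G : ℝ → EuclideanSpace ℝ (Fin n) → EuclideanSpace ℝ (Fin n) := fun t u =>
    perturbedField f g ε t (x₀ (t + θ) + coordinateClip a u) - f (x₀ (t + θ))
  have hG : ∀ t ∈ Icc 0 T, ∀ u, ‖G t u‖ ≤ K * ‖coordinateClip a u‖ + ε * K := fun t ht u => by
    simpa using h.field_sub_velocity_le ht hε (hmem t u)
  have hGlip : ∀ t ∈ Icc 0 T, ∀ u w, ‖G t u - G t w‖ ≤ K * ‖u - w‖ := fun t ht u w => by
    simp only [G, sub_sub_sub_cancel_right]
    refine (h.field_sub_le _ t ht _ (hmem t u) _ (hmem t w) ε hε).trans ?_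
    rw [add_sub_add_left_eq_sub]
    exact mul_le_mul_of_nonneg_left (norm_coordinateClip_sub_le a u w) hK.le
  have hGcont : ∀ u, ContinuousOn (fun t => G t u) (Icc 0 T) := fun u => by
    have hc : ContinuousOn (fun t : ℝ => x₀ (t + θ) + coordinateClip a u) (Icc 0 T) :=
      ((hx₀.continuous.comp (continuous_add_const θ)).add continuous_const).continuousOn
    have hmap : ∀ t ∈ Icc 0 T, x₀ (t + θ) + coordinateClip a u ∈ Ω := fun t _ =>
      h.subset _ (hmem t u)
    refine ContinuousOn.sub (ContinuousOn.add (hf.comp hc hmap) (ContinuousOn.const_smul ?_ ε))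
      (hf.comp (hx₀.continuous.comp (continuous_add_const θ)).continuousOn fun t _ => hx₀.mem _)
    exact hg.continuousOn.comp (continuousOn_id.prodMk (hc.prodMk continuousOn_const))
      fun t ht => ⟨mem_univ _, hmap t ht, hε⟩
  obtain ⟨u, hu0, hu⟩ := exists_solution_of_lipschitz (G := G) (K := K) (L := K * ρ + ε * K) hT
    hGlip hGcont (fun t ht u => (hG t ht u).trans (by gcongr; exact hclip u)) (ζ - x₀ θ)
  have hb := norm_le_exp_mul_of_norm_deriv_le (K := K) (b := ε * K) h.one_le
    (mul_nonneg hε.1 hK.le) hu fun t ht => (hG t (Ico_subset_Icc_self ht) _).trans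
      (by gcongr; exact norm_coordinateClip_le_norm ha0 _)
  rw [hu0] at hb
  have hua : ∀ t ∈ Icc 0 T, coordinateClip a (u t) = u t := fun t ht =>
    coordinateClip_eq_self ((hb t ht).trans hζ)
  refine ⟨fun t => x₀ (t + θ) + u t, ⟨by simp [hu0], fun t ht => ?_, fun t ht => ?_⟩,
    fun t ht => ?_⟩
  · have := h.subset _ (hmem t (u t))
    rwa [hua t ht] at this
  · have h1 := ((hx₀.ode (t + θ)).comp_add_const t θ).hasDerivWithinAt (s := Icc 0 T)
    refine (h1.add (hu t ht)).congr_deriv ?_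
    simp only [G, hua t ht]
    abel
  · rw [add_sub_cancel_left]
    exact hb t ht

/-- Solutions of the perturbed equation starting near the orbit are unique. -/
theorem IsTubeBound.isSolutionFrom_unique (h : IsTubeBound Ω f T εs x₀ g ρ K) {θ ε : ℝ}
    (hx₀ : IsNonconstantPeriodicSolution Ω f T x₀)
    (hε : ε ∈ Icc 0 εs) {ζ : EuclideanSpace ℝ (Fin n)} {x y : ℝ → EuclideanSpace ℝ (Fin n)}
    (hx : IsSolutionFrom Ω (perturbedField f g ε) T ζ x)
    (hxρ : ∀ t ∈ Icc 0 T, ‖x t - x₀ (t + θ)‖ < ρ)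
    (hy : IsSolutionFrom Ω (perturbedField f g ε) T ζ y) :
    ∀ t ∈ Icc 0 T, y t = x t := by
  have hxc : ContinuousOn x (Icc 0 T) := fun t ht => (hx.ode t ht).continuousWithinAt
  have hyc : ContinuousOn y (Icc 0 T) := fun t ht => (hy.ode t ht).continuousWithinAt
  have hoc : Continuous fun t => x₀ (t + θ) := hx₀.continuous.comp (continuous_add_const θ)
  -- The solution `y` is not known to stay in the tube, where the Lipschitz bound holds. As long as
  -- it agrees with `x` it is strictly inside, hence remains there a little longer: the set of
  -- agreement is closed and extends to the right.
  suffices hs : Icc 0 T ⊆ {t | y t = x t} from fun t ht => hs ht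
  refine IsClosed.Icc_subset_of_forall_exists_gt ?_ (hy.init.trans hx.init.symm)
    fun t ht b hb => ?_
  · have : {t | y t = x t} ∩ Icc 0 T = Icc 0 T ∩ (fun t => y t - x t) ⁻¹' {0} := by
      ext t
      simp [sub_eq_zero, and_comm]
    rw [this]
    exact (hyc.sub hxc).preimage_isClosed_of_isClosed isClosed_Icc isClosed_singleton
  · obtain ⟨hteq, ht⟩ := ht
    have ht' := Ico_subset_Icc_self ht
    have hev : ∀ᶠ s in 𝓝[Icc 0 T] t, ‖y s - x₀ (s + θ)‖ < ρ := by
      have hc : ContinuousWithinAt (fun s => ‖y s - x₀ (s + θ)‖) (Icc 0 T) t :=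
        ((hyc t ht').sub hoc.continuousWithinAt).norm
      refine hc.eventually (gt_mem_nhds ?_)
      have hteq' : y t = x t := hteq
      change ‖y t - x₀ (t + θ)‖ < ρ
      rw [hteq']
      exact hxρ t ht'
    obtain ⟨δ, hδ, hδ'⟩ := Metric.eventually_nhds_iff.1 (eventually_nhdsWithin_iff.1 hev)
    set c := min b (min T (t + δ / 2)) with hc
    have hbt : t < b := hb
    have htc : t < c := lt_min hbt (lt_min ht.2 (by linarith))
    have hcT : c ≤ T := (min_le_right _ _).trans (min_le_left _ _)
    have hcδ : c ≤ t + δ / 2 := (min_le_right _ _).trans (min_le_right _ _)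
    have hsub : Icc t c ⊆ Icc 0 T := Icc_subset_Icc ht.1 hcT
    have hder : ∀ {w : ℝ → EuclideanSpace ℝ (Fin n)},
        IsSolutionFrom Ω (perturbedField f g ε) T ζ w → ∀ s ∈ Ico t c,
          HasDerivWithinAt w (perturbedField f g ε s (w s)) (Ici s) s := fun hw s hs =>
      (hw.ode s (hsub (Ico_subset_Icc_self hs))).mono_of_mem_nhdsWithin
        (Icc_mem_nhdsGE_of_mem ⟨ht.1.trans hs.1, hs.2.trans_le hcT⟩)
    have huniq := ODE_solution_unique_of_mem_Icc_right (v := perturbedField f g ε)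
      (s := fun s => closedBall (x₀ (s + θ)) ρ) (K := K.toNNReal) (a := t) (b := c)
      (f := y) (g := x)
      (fun s hs => LipschitzOnWith.of_dist_le_mul fun u hu w hw => by
        rw [dist_eq_norm, dist_eq_norm, Real.coe_toNNReal K h.K_pos.le]
        exact h.field_sub_le _ s (hsub (Ico_subset_Icc_self hs)) u hu w hw ε hε)
      (hyc.mono hsub) (hder hy)
      (fun s hs => by
        rw [mem_closedBall_iff_norm]
        refine (hδ' ?_ (hsub (Ico_subset_Icc_self hs))).le
        rw [Real.dist_eq, abs_of_nonneg (by linarith [hs.1])]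
        linarith [hs.2])
      (hxc.mono hsub) (hder hx)
      (fun s hs => by
        rw [mem_closedBall_iff_norm]
        exact (hxρ s (hsub (Ico_subset_Icc_self hs))).le) hteq
    exact ⟨c, huniq (right_mem_Icc.2 htc.le), htc, min_le_left _ _⟩

/-- For initial values near the orbit and small `ε` the perturbed equation has a solution on
`[0, T]`, and all such solutions stay near the orbit. -/
theorem IsTubeBound.exists_flow_bound (h : IsTubeBound Ω f T εs x₀ g ρ K) (hT : 0 ≤ T)
    (hf : ContinuousOn f Ω)
    (hx₀ : IsNonconstantPeriodicSolution Ω f T x₀) (hg : IsAdmissiblePerturbation Ω T εs g) :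
    ∃ C > 0, ∃ r > 0, C * r ≤ ρ ∧ ∀ θ, ∀ ε ∈ Icc 0 εs, ∀ ζ, ‖ζ - x₀ θ‖ + ε ≤ r →
      (∃ x, IsSolutionFrom Ω (perturbedField f g ε) T ζ x) ∧
      ∀ x, IsSolutionFrom Ω (perturbedField f g ε) T ζ x → ∀ t ∈ Icc 0 T,
        ‖x t - x₀ (t + θ)‖ ≤ C * (‖ζ - x₀ θ‖ + ε) := by
  have hK := h.K_pos
  have hρ := h.pos
  set C := Real.exp (K * T) * K with hC
  have hC0 : 0 < C := by positivity
  have hn : (0:ℝ) ≤ n := Nat.cast_nonneg n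
  -- Using `n + 2` instead of `n + 1` gives a bound strictly below `ρ`, also for `n = 0`, as
  -- uniqueness requires.
  refine ⟨C, hC0, ρ / (n + 2) / C, by positivity, ?_, fun θ ε hε ζ hζ => ?_⟩
  · rw [mul_div_cancel₀ _ hC0.ne']
    exact div_le_self hρ.le (by linarith)
  have h1 : Real.exp (K * T) * (‖ζ - x₀ θ‖ + ε * K) ≤ C * (‖ζ - x₀ θ‖ + ε) := by
    rw [hC, mul_assoc]
    gcongr
    nlinarith [norm_nonneg (ζ - x₀ θ), h.one_le]
  have h2 : C * (‖ζ - x₀ θ‖ + ε) ≤ ρ / (n + 2) := by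
    rwa [le_div_iff₀ hC0, mul_comm] at hζ
  have h3 : ρ / (n + 2) ≤ ρ / (n + 1) := by gcongr; norm_num
  have h4 : ρ / (n + 2) < ρ := div_lt_self hρ (by linarith)
  obtain ⟨x, hx, hxb⟩ := h.exists_isSolutionFrom hT hf hx₀ hg hε (h1.trans (h2.trans h3))
  refine ⟨⟨x, hx⟩, fun y hy t ht => ?_⟩
  rw [h.isSolutionFrom_unique hx₀ hε hx
    (fun t ht => (hxb t ht).trans_lt ((h1.trans h2).trans_lt h4)) hy t ht]
  exact (hxb t ht).trans h1

end Flow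

/-! ### The Poincaré map: linear approximation, analyticity, Malkin's condition. -/

section Poincare

variable {n : ℕ} {Ω : Set (EuclideanSpace ℝ (Fin n))}
  {f : EuclideanSpace ℝ (Fin n) → EuclideanSpace ℝ (Fin n)} {T εs : ℝ}
  {x₀ z₀ : ℝ → EuclideanSpace ℝ (Fin n)}
  {g : ℝ → EuclideanSpace ℝ (Fin n) → ℝ → EuclideanSpace ℝ (Fin n)} {ρ K C r : ℝ}

/-- Near the orbit and for small `ε`, solutions of the perturbed equation exist on `[0, T]` and stay
near the orbit. -/
def IsFlowBound (Ω : Set (EuclideanSpace ℝ (Fin n)))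
    (f : EuclideanSpace ℝ (Fin n) → EuclideanSpace ℝ (Fin n)) (T εs : ℝ)
    (x₀ : ℝ → EuclideanSpace ℝ (Fin n))
    (g : ℝ → EuclideanSpace ℝ (Fin n) → ℝ → EuclideanSpace ℝ (Fin n)) (C r : ℝ) : Prop :=
  ∀ θ, ∀ ε ∈ Icc 0 εs, ∀ ζ, ‖ζ - x₀ θ‖ + ε ≤ r →
    (∃ x, IsSolutionFrom Ω (perturbedField f g ε) T ζ x) ∧
    ∀ x, IsSolutionFrom Ω (perturbedField f g ε) T ζ x → ∀ t ∈ Icc 0 T,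
      ‖x t - x₀ (t + θ)‖ ≤ C * (‖ζ - x₀ θ‖ + ε)

/-- The value comes from an arbitrarily chosen solution; this is why `IsFlowBound` controls every
solution. -/
theorem exists_isSolutionFrom_eq_poincareMap
    {F : ℝ → EuclideanSpace ℝ (Fin n) → EuclideanSpace ℝ (Fin n)} {ζ : EuclideanSpace ℝ (Fin n)}
    (h : ∃ x, IsSolutionFrom Ω F T ζ x) :
    ∃ x, IsSolutionFrom Ω F T ζ x ∧ poincareMap Ω F T ζ = x T := by
  refine ⟨h.choose, h.choose_spec, ?_⟩
  rw [poincareMap, dif_pos h]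

theorem IsFlowBound.mem_closedBall (hb : IsFlowBound Ω f T εs x₀ g C r) (hC : 0 < C)
    (hCr : C * r ≤ ρ) {θ ε : ℝ} (hε : ε ∈ Icc 0 εs) {ζ : EuclideanSpace ℝ (Fin n)}
    (hζ : ‖ζ - x₀ θ‖ + ε ≤ r) {x : ℝ → EuclideanSpace ℝ (Fin n)}
    (hx : IsSolutionFrom Ω (perturbedField f g ε) T ζ x) {t : ℝ} (ht : t ∈ Icc 0 T) :
    x t ∈ closedBall (x₀ (t + θ)) ρ := by
  rw [mem_closedBall_iff_norm]
  exact ((hb θ ε hε ζ hζ).2 x hx t ht).trans ((mul_le_mul_of_nonneg_left hζ hC.le).trans hCr)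

/-- Lipschitz dependence of solutions on the initial value. -/
theorem IsFlowBound.norm_sub_le (hb : IsFlowBound Ω f T εs x₀ g C r) (hC : 0 < C)
    (hCr : C * r ≤ ρ) (h : IsTubeBound Ω f T εs x₀ g ρ K) {θ ε : ℝ} (hε : ε ∈ Icc 0 εs)
    {ζ ζ' : EuclideanSpace ℝ (Fin n)} (hζ : ‖ζ - x₀ θ‖ + ε ≤ r) (hζ' : ‖ζ' - x₀ θ‖ + ε ≤ r)
    {x x' : ℝ → EuclideanSpace ℝ (Fin n)}
    (hx : IsSolutionFrom Ω (perturbedField f g ε) T ζ x)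
    (hx' : IsSolutionFrom Ω (perturbedField f g ε) T ζ' x') {t : ℝ} (ht : t ∈ Icc 0 T) :
    ‖x t - x' t‖ ≤ Real.exp (K * T) * ‖ζ - ζ'‖ := by
  have h1 := norm_le_exp_mul_of_norm_deriv_le (K := K) (b := 0) h.one_le le_rfl
    (fun t ht => (hx.ode t ht).sub (hx'.ode t ht)) (fun t ht => by
      have ht' := Ico_subset_Icc_self ht
      rw [add_zero]
      exact h.field_sub_le _ t ht' _ (hb.mem_closedBall hC hCr hε hζ hx ht') _
        (hb.mem_closedBall hC hCr hε hζ' hx' ht') ε hε) t ht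
  simpa [hx.init, hx'.init] using h1

/-- Lipschitz dependence of the Poincaré map on `ε` at `ε = 0`. -/
theorem IsFlowBound.norm_poincareMap_sub_le (hb : IsFlowBound Ω f T εs x₀ g C r) (hC : 0 < C)
    (hCr : C * r ≤ ρ) (h : IsTubeBound Ω f T εs x₀ g ρ K) (hT : 0 ≤ T) {θ ε : ℝ}
    (hε : ε ∈ Icc 0 εs) {ζ : EuclideanSpace ℝ (Fin n)} (hζ : ‖ζ - x₀ θ‖ + ε ≤ r) :
    ‖poincareMap Ω (perturbedField f g ε) T ζ - poincareMap Ω (perturbedField f g 0) T ζ‖ ≤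
      Real.exp (K * T) * K * ε := by
  have h0 : (0:ℝ) ∈ Icc 0 εs := ⟨le_rfl, hε.1.trans hε.2⟩
  have hζ0 : ‖ζ - x₀ θ‖ + 0 ≤ r := by linarith [hε.1]
  obtain ⟨x, hx, hxT⟩ := exists_isSolutionFrom_eq_poincareMap (hb θ ε hε ζ hζ).1
  obtain ⟨y, hy, hyT⟩ := exists_isSolutionFrom_eq_poincareMap (hb θ 0 h0 ζ hζ0).1
  have h1 := norm_le_exp_mul_of_norm_deriv_le (K := K) (b := ε * K) h.one_le
    (mul_nonneg hε.1 h.K_pos.le)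
    (fun t ht => (hx.ode t ht).sub (hy.ode t ht)) (fun t ht => by
      have ht' := Ico_subset_Icc_self ht
      have hxm := hb.mem_closedBall hC hCr hε hζ hx ht'
      have hym := hb.mem_closedBall hC hCr h0 hζ0 hy ht'
      have h2 : perturbedField f g ε t (x t) - perturbedField f g 0 t (y t) =
          (f (x t) - f (y t)) + ε • g t (x t) ε := by
        simp only [perturbedField, zero_smul]; abel
      rw [h2]
      refine (norm_add_le _ _).trans (add_le_add (h.f_sub_le _ _ hxm _ hym) ?_)
      rw [norm_smul, Real.norm_eq_abs, abs_of_nonneg hε.1]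
      exact mul_le_mul_of_nonneg_left (h.g_le _ t ht' _ hxm ε hε) hε.1) T (right_mem_Icc.2 hT)
  rw [hxT, hyT]
  simpa [hx.init, hy.init, mul_assoc, mul_comm ε K] using h1

/-- With `ε = 0` and initial value on the orbit the flow bound is zero, so any solution is the orbit
itself. -/
theorem IsFlowBound.poincareMap_orbit (hb : IsFlowBound Ω f T εs x₀ g C r) (hr : 0 ≤ r)
    (hT : 0 ≤ T) (hεs : 0 ≤ εs) (hx₀ : Function.Periodic x₀ T) (θ : ℝ) :
    poincareMap Ω (perturbedField f g 0) T (x₀ θ) = x₀ θ := by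
  have h := hb θ 0 (left_mem_Icc.2 hεs) (x₀ θ) (by simpa using hr)
  obtain ⟨x, hx, hxT⟩ := exists_isSolutionFrom_eq_poincareMap h.1
  have h1 := h.2 x hx T (right_mem_Icc.2 hT)
  rw [sub_self, norm_zero, add_zero, mul_zero, norm_le_zero_iff, sub_eq_zero, add_comm,
    hx₀ θ] at h1
  rw [hxT, h1]

/-- The Poincaré map is approximated by the monodromy operator of the variational equation. -/
theorem IsFlowBound.exists_approximatesLinear (hb : IsFlowBound Ω f T εs x₀ g C r) (hC : 0 < C)
    (hr : 0 < r) (hCr : C * r ≤ ρ) (h : IsTubeBound Ω f T εs x₀ g ρ K) (hT : 0 < T)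
    (hΩ : IsOpen Ω) (hf : AnalyticOnNhd ℝ f Ω) (hx₀ : IsNonconstantPeriodicSolution Ω f T x₀)
    {θ : ℝ} {Z : ℝ → EuclideanSpace ℝ (Fin n) →L[ℝ] EuclideanSpace ℝ (Fin n)}
    (hZ0 : Z 0 = ContinuousLinearMap.id ℝ _)
    (hZ : ∀ t, HasDerivAt Z ((fderiv ℝ f (x₀ (t + θ))).comp (Z t)) t) {κ : ℝ} (hκ : 0 < κ) :
    ∃ r' > 0, r' ≤ r ∧ ∀ ε ∈ Icc 0 εs, ∀ ζ ζ', ‖ζ - x₀ θ‖ + ε ≤ r' → ‖ζ' - x₀ θ‖ + ε ≤ r' →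
      ‖poincareMap Ω (perturbedField f g ε) T ζ - poincareMap Ω (perturbedField f g ε) T ζ' -
        Z T (ζ - ζ')‖ ≤ κ * ‖ζ - ζ'‖ := by
  set e := Real.exp (K * T) with he
  have he0 : 0 < e := Real.exp_pos _
  have hK := h.K_pos
  -- The two errors, from linearising `f` and from `ε • g`, are each at most `η * ‖x - x'‖`. One
  -- factor `e` bounds `‖x - x'‖` by the initial distance; the other comes from Grönwall's
  -- inequality for `x - x' - Z (ζ - ζ')`.
  set η := κ / (2 * (e * e)) with hη
  have hη0 : 0 < η := by positivity
  obtain ⟨ρ', hρ', hlin⟩ := hx₀.exists_approximatesLinear hΩ hf hT.ne' hη0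
  refine ⟨min r (min (ρ' / C) (η / K)), by positivity, min_le_left _ _,
    fun ε hε ζ ζ' hζ hζ' => ?_⟩
  have hζr := hζ.trans (min_le_left _ _)
  have hζr' := hζ'.trans (min_le_left _ _)
  have hm : ∀ ζ, ‖ζ - x₀ θ‖ + ε ≤ min r (min (ρ' / C) (η / K)) → ∀ x,
      IsSolutionFrom Ω (perturbedField f g ε) T ζ x → ∀ t ∈ Icc 0 T,
      x t ∈ closedBall (x₀ (t + θ)) ρ' := fun ζ hζ x hx t ht => by
    rw [mem_closedBall_iff_norm]
    refine ((hb θ ε hε ζ (hζ.trans (min_le_left _ _))).2 x hx t ht).trans ?_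
    have := hζ.trans ((min_le_right _ _).trans (min_le_left _ _))
    rwa [le_div_iff₀ hC, mul_comm] at this
  have hεK : ε * K ≤ η := by
    have h1 := hζ.trans ((min_le_right _ _).trans (min_le_right _ _))
    rw [le_div_iff₀ hK] at h1
    nlinarith [mul_nonneg (norm_nonneg (ζ - x₀ θ)) hK.le]
  obtain ⟨x, hx, hxT⟩ := exists_isSolutionFrom_eq_poincareMap (hb θ ε hε ζ hζr).1
  obtain ⟨x', hx', hxT'⟩ := exists_isSolutionFrom_eq_poincareMap (hb θ ε hε ζ' hζr').1
  have hZw : ∀ t, HasDerivWithinAt (fun t => Z t (ζ - ζ'))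
      (fderiv ℝ f (x₀ (t + θ)) (Z t (ζ - ζ'))) (Icc 0 T) t := fun t =>
    (((hZ t).clm_apply (hasDerivAt_const t (ζ - ζ'))).congr_deriv (by simp)).hasDerivWithinAt
  have h1 := norm_le_exp_mul_of_norm_deriv_le (K := K) (b := 2 * η * (e * ‖ζ - ζ'‖)) h.one_le
    (by positivity)
    (fun t ht => ((hx.ode t ht).sub (hx'.ode t ht)).sub (hZw t)) (fun t ht => by
      have ht' := Ico_subset_Icc_self ht
      have hd := hb.norm_sub_le hC hCr h hε hζr hζr' hx hx' ht'
      have hxm := hb.mem_closedBall hC hCr hε hζr hx ht'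
      have hxm' := hb.mem_closedBall hC hCr hε hζr' hx' ht'
      have h2 := hlin (t + θ) _ (hm ζ hζ x hx t ht') _ (hm ζ' hζ' x' hx' t ht')
      have h3 := h.g_sub_le _ t ht' _ hxm ε hε _ hxm' ε hε
      rw [sub_self, abs_zero, add_zero] at h3
      have h4 := (fderiv ℝ f (x₀ (t + θ))).le_of_opNorm_le (h.fderiv_le _)
        (x t - x' t - Z t (ζ - ζ'))
      have h5 : perturbedField f g ε t (x t) - perturbedField f g ε t (x' t) -
          fderiv ℝ f (x₀ (t + θ)) (Z t (ζ - ζ')) =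
          fderiv ℝ f (x₀ (t + θ)) (x t - x' t - Z t (ζ - ζ')) +
          ((f (x t) - f (x' t) - fderiv ℝ f (x₀ (t + θ)) (x t - x' t)) +
            ε • (g t (x t) ε - g t (x' t) ε)) := by
        simp only [perturbedField, smul_sub, map_sub]; abel
      have h6 : ‖ε • (g t (x t) ε - g t (x' t) ε)‖ ≤ η * ‖x t - x' t‖ := by
        rw [norm_smul, Real.norm_eq_abs, abs_of_nonneg hε.1]
        calc ε * ‖g t (x t) ε - g t (x' t) ε‖ ≤ ε * (K * ‖x t - x' t‖) :=
              mul_le_mul_of_nonneg_left h3 hε.1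
          _ = ε * K * ‖x t - x' t‖ := by ring
          _ ≤ η * ‖x t - x' t‖ := by gcongr
      rw [h5]
      refine (norm_add_le _ _).trans (add_le_add h4 ((norm_add_le _ _).trans ?_))
      have h7 : η * ‖x t - x' t‖ ≤ η * (e * ‖ζ - ζ'‖) := by gcongr
      linarith) T (right_mem_Icc.2 hT.le)
  have h8 : e * (2 * η * (e * ‖ζ - ζ'‖)) = κ * ‖ζ - ζ'‖ := by
    rw [hη]; field_simp
  rw [hxT, hxT', ← h8]
  simpa [hx.init, hx'.init, hZ0] using h1

/-- The Poincaré map is analytic near the orbit. -/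
theorem IsFlowBound.analyticAt_poincareMap (hb : IsFlowBound Ω f T εs x₀ g C r) (hC : 0 < C)
    (hCr : C * r ≤ ρ) (h : IsTubeBound Ω f T εs x₀ g ρ K) (hT : 0 < T)
    (hf : AnalyticOnNhd ℝ f Ω) (hg : IsAdmissiblePerturbation Ω T εs g) {θ ε : ℝ}
    (hε : ε ∈ Icc 0 εs) {ζ₀ : EuclideanSpace ℝ (Fin n)} (hζ₀ : ‖ζ₀ - x₀ θ‖ + ε < r) :
    AnalyticAt ℝ (poincareMap Ω (perturbedField f g ε) T) ζ₀ := by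
  have hcont : Continuous fun ζ : EuclideanSpace ℝ (Fin n) => ‖ζ - x₀ θ‖ + ε := by fun_prop
  have hev : ∀ᶠ ζ in 𝓝 ζ₀, ‖ζ - x₀ θ‖ + ε < r :=
    hcont.continuousAt.eventually (gt_mem_nhds hζ₀)
  classical
  -- The same choice of solution as in `poincareMap`, with a matching default, so that `x ζ T` is
  -- its value for every `ζ`.
  let x : EuclideanSpace ℝ (Fin n) → ℝ → EuclideanSpace ℝ (Fin n) := fun ζ =>
    if hex : ∃ x, IsSolutionFrom Ω (perturbedField f g ε) T ζ x then hex.choose else 0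
  have hsol : ∀ ζ, ‖ζ - x₀ θ‖ + ε < r → IsSolutionFrom Ω (perturbedField f g ε) T ζ (x ζ) := by
    intro ζ hζ
    have hex := (hb θ ε hε ζ hζ.le).1
    simp only [x, dif_pos hex]
    exact hex.choose_spec
  have hP : poincareMap Ω (perturbedField f g ε) T = fun ζ => x ζ T := by
    ext1 ζ
    by_cases hex : ∃ x, IsSolutionFrom Ω (perturbedField f g ε) T ζ x
    · simp only [x, poincareMap, dif_pos hex]
    · simp only [x, poincareMap, dif_neg hex, Pi.zero_apply]
  rw [hP]
  refine analyticAt_solution hT.le (F := perturbedField f g ε) ?_ ?_ (fun t ht => ?_) ?_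
  · filter_upwards [hev] with ζ hζ
    exact (hsol ζ hζ).ode
  · rw [Metric.tendstoUniformlyOn_iff]
    intro δ hδ
    have he : 0 < Real.exp (K * T) := Real.exp_pos _
    filter_upwards [hev, Metric.ball_mem_nhds ζ₀ (div_pos hδ he)] with ζ hζ hζδ t ht
    rw [mem_ball, dist_comm, dist_eq_norm, lt_div_iff₀ he, mul_comm] at hζδ
    rw [dist_eq_norm]
    exact (hb.norm_sub_le hC hCr h hε hζ₀.le hζ.le (hsol _ hζ₀) (hsol _ hζ) ht).trans_lt hζδ
  · exact hg.uniformlyAnalyticAt hf hT.ne' hε ((hsol _ hζ₀).mem t ht)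
  · refine analyticAt_id.congr ?_
    filter_upwards [hev] with ζ hζ
    exact (hsol ζ hζ).init.symm

/-- Malkin's necessary condition: if `M θ ≠ 0`, then for small `ε > 0` the Poincaré map has no fixed
point at distance `O(ε)` from `x₀ θ`. -/
theorem IsFlowBound.eventually_not_isFixedPt (hb : IsFlowBound Ω f T εs x₀ g C r) (hC : 0 < C)
    (hr : 0 < r) (hCr : C * r ≤ ρ) (h : IsTubeBound Ω f T εs x₀ g ρ K) (hT : 0 < T)
    (hΩ : IsOpen Ω) (hf : AnalyticOnNhd ℝ f Ω) (hx₀ : IsNonconstantPeriodicSolution Ω f T x₀)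
    (hz₀ : IsNormalizedAdjointSolution f T x₀ z₀) (hεs : 0 < εs)
    (hg : IsAdmissiblePerturbation Ω T εs g) {θ : ℝ} (hM : malkinFunction T g x₀ z₀ θ ≠ 0)
    {D : ℝ} (hD : 0 ≤ D) :
    ∃ ε₁ > 0, ∀ ε, 0 < ε → ε < ε₁ → ∀ ζ, ‖ζ - x₀ θ‖ ≤ D * ε →
      poincareMap Ω (perturbedField f g ε) T ζ ≠ ζ := by
  have hz₀c : Continuous z₀ := continuous_iff_continuousAt.2 fun t => (hz₀.ode t).continuousAt
  obtain ⟨B, hB⟩ := isBounded_iff_forall_norm_le.1 (hz₀.periodic.isBounded_of_continuous hT.ne' hz₀c)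
  have hB' : ∀ t, ‖z₀ t‖ ≤ B := fun t => hB _ ⟨t, rfl⟩
  have hB0 : 0 ≤ B := (norm_nonneg _).trans (hB' 0)
  have hK := h.K_pos
  set M := malkinFunction T g x₀ z₀ θ with hMdef
  have hM0 : 0 < |M| := abs_pos.2 hM
  set D' := C * (D + 1) with hD'
  have hD'0 : 0 < D' := by positivity
  set Q := T * B with hQ
  have hQ0 : 0 ≤ Q := by positivity
  -- The linearisation error is to use less than half of `|M|`; smallness of `ε` takes care of the
  -- other half.
  set η := |M| / (2 * (Q * D' + 1)) with hη
  have hη0 : 0 < η := by positivity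
  obtain ⟨ρ', hρ', hlin⟩ := hx₀.exists_approximatesLinear hΩ hf hT.ne' hη0
  refine ⟨min εs (min (r / (D + 1)) (min (ρ' / D') (|M| / (2 * (Q * (K * (D' + 1)) + 1))))),
    by positivity, fun ε hε0 hε1 ζ hζ hfix => ?_⟩
  have hεm : ε ∈ Icc 0 εs := ⟨hε0.le, hε1.le.trans (min_le_left _ _)⟩
  have hεr : (D + 1) * ε ≤ r := by
    have := hε1.le.trans ((min_le_right _ _).trans (min_le_left _ _))
    rwa [le_div_iff₀ (by positivity), mul_comm] at this
  have hερ : D' * ε ≤ ρ' := by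
    have := hε1.le.trans ((min_le_right _ _).trans ((min_le_right _ _).trans (min_le_left _ _)))
    rwa [le_div_iff₀ (by positivity), mul_comm] at this
  have hεM : Q * (K * (D' + 1) * ε) < |M| / 2 := by
    have := hε1.trans_le ((min_le_right _ _).trans ((min_le_right _ _).trans (min_le_right _ _)))
    rw [lt_div_iff₀ (by positivity)] at this
    linarith
  have hηM : Q * (η * D') < |M| / 2 := by
    have : η * (2 * (Q * D' + 1)) = |M| := div_mul_cancel₀ _ (by positivity)
    linarith
  have hζr : ‖ζ - x₀ θ‖ + ε ≤ r := by linarith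
  have hflow := hb θ ε hεm ζ hζr
  obtain ⟨x, hx, hxT⟩ := exists_isSolutionFrom_eq_poincareMap hflow.1
  have hw : ∀ t ∈ Icc 0 T, ‖x t - x₀ (t + θ)‖ ≤ D' * ε := fun t ht => by
    refine (hflow.2 x hx t ht).trans ?_
    rw [hD', mul_assoc]
    gcongr
    linarith
  let m : ℝ → ℝ := fun t => inner ℝ (g t (x₀ (t + θ)) 0) (z₀ (t + θ))
  have hoc : Continuous fun t => x₀ (t + θ) := hx₀.continuous.comp (continuous_add_const θ)
  have hmc : Continuous m := by
    refine Continuous.inner ?_ (hz₀c.comp (continuous_add_const θ))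
    have h0 : (0:ℝ) ∈ Icc 0 εs := left_mem_Icc.2 hεs.le
    exact hg.continuousOn.comp_continuous
      (f := fun t : ℝ => (t, x₀ (t + θ), (0:ℝ)))
      (continuous_id.prodMk (hoc.prodMk continuous_const))
      fun t => ⟨mem_univ _, hx₀.mem _, h0⟩
  -- Pairing the deviation with the adjoint solution cancels the linear terms, and subtracting `ε ∫
  -- m` removes the leading forcing. At a fixed point `ψ` changes by `-ε M` over the period, while
  -- the remainder `ψ'` is too small to allow it.
  let ψ : ℝ → ℝ := fun t => inner ℝ (x t - x₀ (t + θ)) (z₀ (t + θ)) - ε * ∫ s in (0:ℝ)..t, m s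
  let ψ' : ℝ → ℝ := fun t =>
    inner ℝ ((f (x t) - f (x₀ (t + θ)) - fderiv ℝ f (x₀ (t + θ)) (x t - x₀ (t + θ))) +
      ε • (g t (x t) ε - g t (x₀ (t + θ)) 0)) (z₀ (t + θ))
  have hψ : ∀ t ∈ Icc 0 T, HasDerivWithinAt ψ (ψ' t) (Icc 0 T) t := by
    intro t ht
    have h1 := ((hx₀.ode (t + θ)).comp_add_const t θ).hasDerivWithinAt (s := Icc 0 T)
    have h2 := ((hz₀.ode (t + θ)).comp_add_const t θ).hasDerivWithinAt (s := Icc 0 T)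
    have h3 : HasDerivWithinAt (fun t => ∫ s in (0:ℝ)..t, m s) (m t) (Icc 0 T) t :=
      (hmc.integral_hasStrictDerivAt 0 t).hasDerivAt.hasDerivWithinAt
    refine ((((hx.ode t ht).sub h1).inner ℝ h2).sub (h3.const_mul ε)).congr_deriv ?_
    simp only [ψ', m, perturbedField, inner_neg_right, ContinuousLinearMap.adjoint_inner_right,
      inner_add_left, inner_sub_left, inner_smul_left, RCLike.conj_to_real, Pi.sub_apply]
    ring
  have hψb : ∀ t ∈ Ico 0 T, ‖ψ' t‖ ≤ (η * D' + K * (D' + 1) * ε) * ε * B := by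
    intro t ht
    have ht' := Ico_subset_Icc_self ht
    have h1 := hlin (t + θ) (x t) (mem_closedBall_iff_norm.2 ((hw t ht').trans hερ)) _
      (mem_closedBall_self hρ'.le)
    have h2 := h.g_sub_le (t + θ) t ht' _ (hb.mem_closedBall hC hCr hεm hζr hx ht') ε hεm _
      (h.center_mem _) 0 (left_mem_Icc.2 hεs.le)
    rw [sub_zero, abs_of_pos hε0] at h2
    refine (norm_inner_le_norm _ _).trans (mul_le_mul ?_ (hB' _) (norm_nonneg _) (by positivity))
    refine (norm_add_le _ _).trans ?_
    rw [norm_smul, Real.norm_eq_abs, abs_of_pos hε0]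
    have h3 := hw t ht'
    calc _ ≤ η * (D' * ε) + ε * (K * (D' * ε + ε)) := by
          gcongr
          · exact h1.trans (by gcongr)
          · exact h2.trans (by gcongr)
      _ = (η * D' + K * (D' + 1) * ε) * ε := by ring
  have hfin := norm_image_sub_le_of_norm_deriv_le_segment' hψ hψb T (right_mem_Icc.2 hT.le)
  have hψT : ψ T - ψ 0 = -(ε * M) := by
    have h1 : x T = x 0 := by rw [← hxT, hfix, hx.init]
    have h2 : x₀ (T + θ) = x₀ θ := by rw [add_comm]; exact hx₀.periodic θ
    have h3 : z₀ (T + θ) = z₀ θ := by rw [add_comm]; exact hz₀.periodic θ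
    simp only [ψ, h1, h2, h3, zero_add, intervalIntegral.integral_same, mul_zero, sub_zero]
    simp only [hMdef, malkinFunction, m]
    ring
  rw [hψT, norm_neg, Real.norm_eq_abs, abs_mul, abs_of_pos hε0, sub_zero] at hfin
  have h9 : ε * |M| ≤ ε * (Q * (η * D') + Q * (K * (D' + 1) * ε)) := by
    calc ε * |M| ≤ _ := hfin
      _ = _ := by rw [hQ]; ring
  have h10 := le_of_mul_le_mul_left h9 hε0
  linarith

end Poincare

/-! ### Lyapunov–Schmidt reduction. -/

section Reduction

variable {E : Type*} [NormedAddCommGroup E] [InnerProductSpace ℝ E] [FiniteDimensional ℝ E]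

/-- In finite dimension, an injective continuous endomorphism is an isomorphism. -/
theorem exists_continuousLinearEquiv_of_ker {A : E →L[ℝ] E} (hA : ∀ w, A w = 0 → w = 0) :
    ∃ i : E ≃L[ℝ] E, (i : E →L[ℝ] E) = A := by
  have hinj : Function.Injective A.toLinearMap := (injective_iff_map_eq_zero _).2 hA
  exact ⟨(LinearEquiv.ofInjectiveEndo _ hinj).toContinuousLinearEquiv, by ext w; rfl⟩

/-- **Lyapunov–Schmidt reduction** for fixed points of an analytic map which is close to a linear map
having `1` as a simple eigenvalue: either there are finitely many fixed points near `c`, or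
near every point `y` there is a fixed point, at a distance controlled by `‖P y - y‖`. -/
theorem exists_lyapunovSchmidt_alternative (B : E →L[ℝ] E) (c v z : E) (hvz : inner ℝ v z = (1 : ℝ))
    (hker : ∀ w, B w = w → ∃ a : ℝ, w = a • v)
    (hleft : ∀ w, inner ℝ (B w) z = (inner ℝ w z : ℝ)) :
    ∃ κ > 0, ∃ D > 0, ∀ R₀ > 0, ∃ R > 0, ∃ ν > 0, R ≤ R₀ ∧ ∀ P : E → E,
      AnalyticOnNhd ℝ P (ball c R₀) →
      (∀ ζ ∈ ball c R₀, ∀ ζ' ∈ ball c R₀, ‖P ζ - P ζ' - B (ζ - ζ')‖ ≤ κ * ‖ζ - ζ'‖) →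
      ‖P c - c‖ ≤ ν →
      {ζ ∈ ball c R | Function.IsFixedPt P ζ}.Finite ∨
      ∀ y ∈ ball c R, ∃ ζ, P ζ = ζ ∧ ‖ζ - y‖ ≤ D * ‖P y - y‖ := by
  have hv0 : v ≠ 0 := by
    rintro rfl
    rw [inner_zero_left] at hvz
    exact zero_ne_one hvz
  have hnt : Nontrivial E := ⟨v, 0, hv0⟩
  have hv : 0 < ‖v‖ := norm_pos_iff.2 hv0
  let σ : E →L[ℝ] ℝ := innerSL ℝ z
  have hσ : ∀ w, σ w = inner ℝ w z := fun w => by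
    simp [σ, real_inner_comm]
  have hσv : σ v = 1 := by rw [hσ, hvz]
  have hσle : ∀ w, |σ w| ≤ ‖w‖ * ‖z‖ := fun w => by
    rw [hσ]; exact abs_real_inner_le_norm w z
  let Q : E →L[ℝ] E := ContinuousLinearMap.id ℝ E - σ.smulRight v
  have hQ : ∀ w, Q w = w - σ w • v := fun w => rfl
  have hσQ : ∀ w, σ (Q w) = 0 := fun w => by
    rw [hQ, map_sub, map_smul, hσv, smul_eq_mul, mul_one, sub_self]
  set b := 1 + ‖z‖ * ‖v‖ with hb
  have hb0 : 0 < b := by positivity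
  have hQle : ∀ w, ‖Q w‖ ≤ b * ‖w‖ := fun w => by
    rw [hQ]
    refine (norm_sub_le _ _).trans ?_
    rw [norm_smul, Real.norm_eq_abs, hb]
    nlinarith [mul_le_mul_of_nonneg_right (hσle w) hv.le]
  -- `A` is injective: applying `σ` to `A w = 0` gives `σ w = 0`, the left eigenvector gives `σ (B w
  -- - w) = 0`, so `B w = w` and `w` is a multiple of `v` killed by `σ`.
  let A : E →L[ℝ] E := Q.comp (B - ContinuousLinearMap.id ℝ E) + σ.smulRight v
  have hA : ∀ w, A w = Q (B w - w) + σ w • v := fun w => rfl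
  obtain ⟨L, hL⟩ := exists_continuousLinearEquiv_of_ker (A := A) fun w hw => by
    rw [hA] at hw
    have h1 : σ w = 0 := by
      have := congrArg σ hw
      rwa [map_add, hσQ, zero_add, map_smul, hσv, smul_eq_mul, mul_one, map_zero] at this
    have h2 : σ (B w - w) = 0 := by rw [map_sub, hσ, hσ, hleft, sub_self]
    rw [h1, zero_smul, add_zero, hQ, h2, zero_smul, sub_zero, sub_eq_zero] at hw
    obtain ⟨a, rfl⟩ := hker w hw
    rw [map_smul, hσv, smul_eq_mul, mul_one] at h1
    rw [h1, zero_smul]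
  set N := ‖(L.symm : E →L[ℝ] E)‖₊ with hN
  have hN0 : 0 < N := L.nnnorm_symm_pos
  have hN0' : (0 : ℝ) < N := hN0
  have hLle : ∀ w, ‖w‖ ≤ N * ‖L w‖ := fun w => by
    have := (L.symm : E →L[ℝ] E).le_opNorm (L w)
    simpa [hN] using this
  have hhalf : N⁻¹ / 2 < N⁻¹ := NNReal.half_lt_self (inv_pos.2 hN0).ne'
  have hcoe : ((N⁻¹ / 2 : NNReal) : ℝ) = (N : ℝ)⁻¹ / 2 := by push_cast; rfl
  refine ⟨(N : ℝ)⁻¹ / 2 / b, by positivity, 2 * N * b, by positivity, fun R₀ hR₀ => ?_⟩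
  -- The image under `Φ` (below) of the closed ball of radius `R₀ / 2` contains the ball of radius
  -- `q` about `Φ c`. Half of `q` is spent on `‖Φ c‖`, through `ν`, and half on `‖s • v‖`, through
  -- `sm`.
  set q := (N : ℝ)⁻¹ / 2 * (R₀ / 2) with hq
  have hq0 : 0 < q := by positivity
  set sm := q / (2 * ‖v‖) with hsm
  have hsm0 : 0 < sm := by positivity
  refine ⟨min R₀ (sm / (‖z‖ + 1)), by positivity, q / (2 * b), by positivity, min_le_left _ _,
    fun P hP hPB hPc => ?_⟩
  set R := min R₀ (sm / (‖z‖ + 1)) with hR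
  have hRσ : R * ‖z‖ < sm := by
    have h1 : R * (‖z‖ + 1) ≤ sm := by
      rw [← le_div_iff₀ (by positivity)]; exact min_le_right _ _
    have h2 : 0 < R := by positivity
    linarith
  have hσR : ∀ ζ ∈ ball c R, |σ (ζ - c)| ≤ R * ‖z‖ := fun ζ hζ => (hσle _).trans
    (mul_le_mul_of_nonneg_right (mem_ball_iff_norm.1 hζ).le (norm_nonneg _))
  have hsub : ball c R ⊆ ball c R₀ := ball_subset_ball (min_le_left _ _)
  -- The projected equation together with the coordinate along `v`. A fixed point satisfies `Φ ζ = σ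
  -- (ζ - c) • v`, so fixed points lie on the preimage of the line through `v`.
  let Φ : E → E := fun ζ => Q (P ζ - ζ) + σ (ζ - c) • v
  have hσΦ : ∀ ζ, σ (Φ ζ) = σ (ζ - c) := fun ζ => by
    simp only [Φ]
    rw [map_add, hσQ, map_smul, hσv, smul_eq_mul, mul_one, zero_add]
  have hΦL : ApproximatesLinearOn Φ (L : E →L[ℝ] E) (ball c R₀) (N⁻¹ / 2) := by
    intro ζ hζ ζ' hζ'
    have h1 : Φ ζ - Φ ζ' - (L : E →L[ℝ] E) (ζ - ζ') = Q (P ζ - P ζ' - B (ζ - ζ')) := by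
      rw [hL, hA]
      simp only [Φ, map_sub, sub_smul]
      abel
    rw [h1, hcoe]
    refine (hQle _).trans ?_
    calc b * ‖P ζ - P ζ' - B (ζ - ζ')‖ ≤ b * ((N : ℝ)⁻¹ / 2 / b * ‖ζ - ζ'‖) :=
          mul_le_mul_of_nonneg_left (hPB ζ hζ ζ' hζ') hb0.le
      _ = (N : ℝ)⁻¹ / 2 * ‖ζ - ζ'‖ := by field_simp
  have hΦa : AnalyticOnNhd ℝ Φ (ball c R₀) := fun ζ hζ =>
    ((Q.analyticAt _).comp ((hP ζ hζ).sub analyticAt_id)).add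
      (((σ.analyticAt _).comp (analyticAt_id.sub analyticAt_const)).smul analyticAt_const)
  let e := hΦL.toOpenPartialHomeomorph Φ (ball c R₀) (Or.inr hhalf) isOpen_ball
  have hlow : ∀ w ∈ ball c R₀, ∀ w' ∈ ball c R₀, ‖w - w'‖ ≤ 2 * N * ‖Φ w - Φ w'‖ := by
    intro w hw w' hw'
    have h1 := hΦL w hw w' hw'
    rw [hcoe] at h1
    have h2 := hLle (w - w')
    have h3 : ‖L (w - w')‖ ≤ ‖Φ w - Φ w'‖ + (N : ℝ)⁻¹ / 2 * ‖w - w'‖ := by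
      have := norm_le_norm_add_norm_sub (Φ w - Φ w') (L (w - w'))
      exact this.trans (add_le_add_right h1 _)
    have h4 := mul_le_mul_of_nonneg_left h3 hN0'.le
    have h5 : (N : ℝ) * ((N : ℝ)⁻¹ / 2 * ‖w - w'‖) = ‖w - w'‖ / 2 := by field_simp
    linarith
  have htarget : ∀ s : ℝ, |s| < sm → s • v ∈ e.target := by
    intro s hs
    have h1 := hΦL.closedBall_subset_target (Or.inr hhalf) isOpen_ball (b := c) (ε := R₀ / 2)
      (by positivity) (closedBall_subset_ball (by linarith))
    refine h1 ?_
    have hN2 : (((N⁻¹ : NNReal) : ℝ) - ((N⁻¹ / 2 : NNReal) : ℝ)) * (R₀ / 2) = q := by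
      rw [hcoe, hq, NNReal.coe_inv]; ring
    rw [mem_closedBall_iff_norm]
    refine le_trans ?_ hN2.ge
    have h2 : ‖Φ c‖ ≤ q / 2 := by
      simp only [Φ, sub_self, map_zero, zero_smul, add_zero]
      refine (hQle _).trans ((mul_le_mul_of_nonneg_left hPc hb0.le).trans_eq ?_)
      field_simp
    have h3 : ‖s • v‖ ≤ q / 2 := by
      rw [norm_smul, Real.norm_eq_abs]
      refine (mul_le_mul_of_nonneg_right hs.le hv.le).trans_eq ?_
      rw [hsm]; field_simp
    linarith [norm_sub_le (s • v) (Φ c)]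
  let γ : ℝ → E := fun s => e.symm (s • v)
  have hγmem : ∀ s, |s| < sm → γ s ∈ ball c R₀ := fun s hs => e.map_target (htarget s hs)
  have hγΦ : ∀ s, |s| < sm → Φ (γ s) = s • v := fun s hs => e.right_inv (htarget s hs)
  have hγa : ∀ s, |s| < sm → AnalyticAt ℝ γ s := by
    intro s hs
    -- The derivative of `Φ` differs from `L` by at most `N⁻¹ / 2`, hence is invertible and the
    -- local inverse is analytic.
    have hd := (hΦa _ (hγmem s hs)).differentiableAt.hasFDerivAt
    have hdL : ‖fderiv ℝ Φ (γ s) - L‖ ≤ ((N⁻¹ / 2 : NNReal) : ℝ) :=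
      (hd.sub (L : E →L[ℝ] E).hasFDerivAt).le_of_lipschitzOn
        (isOpen_ball.mem_nhds (hγmem s hs)) hΦL.lipschitzOnWith
    obtain ⟨i, hi⟩ := exists_continuousLinearEquiv_of_ker (A := fderiv ℝ Φ (γ s)) fun w hw => by
      have h1 := (fderiv ℝ Φ (γ s) - L).le_of_opNorm_le hdL w
      rw [hcoe, sub_apply, hw, zero_sub, norm_neg] at h1
      have h2 := mul_le_mul_of_nonneg_left h1 hN0'.le
      have h3 : (N : ℝ) * ((N : ℝ)⁻¹ / 2 * ‖w‖) = ‖w‖ / 2 := by field_simp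
      have h4 : ‖w‖ ≤ N * ‖(L : E →L[ℝ] E) w‖ := hLle w
      exact norm_le_zero_iff.1 (by linarith)
    have h5 : AnalyticAt ℝ e.symm (s • v) :=
      e.analyticAt_symm (htarget s hs) (hΦa _ (hγmem s hs)) hi.symm
    have h6 : AnalyticAt ℝ (fun s : ℝ => s • v) s := analyticAt_id.smul analyticAt_const
    exact AnalyticAt.comp (g := e.symm) (f := fun s : ℝ => s • v) h5 h6
  -- The scalar bifurcation function: on the arc the `Q`-component of `P - id` already vanishes.
  let ψ : ℝ → ℝ := fun s => σ (P (γ s) - γ s)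
  have hψa : AnalyticOnNhd ℝ ψ (Ioo (-sm) sm) := fun s hs => by
    have hs' := abs_lt.2 hs
    exact (σ.analyticAt _).comp (((hP _ (hγmem s hs')).comp (hγa s hs')).sub (hγa s hs'))
  have hγfix : ∀ s, |s| < sm → ψ s = 0 → P (γ s) = γ s := by
    intro s hs hψ
    have h1 := hγΦ s hs
    have h2 : σ (γ s - c) = s := by
      rw [← hσΦ, h1, map_smul, hσv, smul_eq_mul, mul_one]
    have h3 : Q (P (γ s) - γ s) = 0 := by
      simp only [Φ, h2] at h1
      simpa using h1
    have h4 : σ (P (γ s) - γ s) = 0 := hψ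
    rw [hQ, h4, zero_smul, sub_zero, sub_eq_zero] at h3
    exact h3
  by_cases hfin : {ζ ∈ ball c R | Function.IsFixedPt P ζ}.Finite
  · exact Or.inl hfin
  refine Or.inr fun y hy => ?_
  have hfixΦ : ∀ ζ, P ζ = ζ → Φ ζ = σ (ζ - c) • v := fun ζ hζ => by
    simp only [Φ, hζ, sub_self, map_zero, zero_add]
  have hinj : InjOn (fun ζ => σ (ζ - c)) {ζ ∈ ball c R | Function.IsFixedPt P ζ} := by
    intro ζ hζ ζ' hζ' h
    have h1 : Φ ζ = Φ ζ' := by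
      rw [hfixΦ ζ hζ.2, hfixΦ ζ' hζ'.2]
      exact congrArg (· • v) h
    have h2 := hlow ζ (hsub hζ.1) ζ' (hsub hζ'.1)
    rw [h1, sub_self, norm_zero, mul_zero] at h2
    exact sub_eq_zero.1 (norm_le_zero_iff.1 h2)
  have hinf := Set.Infinite.image hinj hfin
  -- Since `R * ‖z‖ < sm`, the parameters accumulate inside the open interval where `ψ` is analytic,
  -- and the identity theorem applies.
  obtain ⟨s₀, hs₀, hacc⟩ := hinf.exists_accPt_of_subset_isCompact
    (isCompact_Icc (a := -(R * ‖z‖)) (b := R * ‖z‖)) (by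
      rintro _ ⟨ζ, hζ, rfl⟩
      exact abs_le.1 (hσR ζ hζ.1))
  have hfreq : ∃ᶠ s in 𝓝[≠] s₀, ψ s = 0 := by
    rw [accPt_iff_frequently] at hacc
    rw [frequently_nhdsWithin_iff]
    refine hacc.mono ?_
    rintro _ ⟨hne, ζ, hζ, rfl⟩
    refine ⟨?_, hne⟩
    have h1 : γ (σ (ζ - c)) = ζ := by
      simp only [γ]
      rw [← hfixΦ ζ hζ.2]
      exact e.left_inv (hsub hζ.1)
    simp only [ψ, h1]
    have h2 : P ζ = ζ := hζ.2
    rw [h2, sub_self, map_zero]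
  have hψ0 := hψa.eqOn_zero_of_preconnected_of_frequently_eq_zero isPreconnected_Ioo
    (z₀ := s₀) ⟨by linarith [hs₀.1], by linarith [hs₀.2]⟩ hfreq
  have hs : |σ (y - c)| < sm := (hσR y hy).trans_lt hRσ
  -- The point of the arc with the same `v`-coordinate as `y`: its `Φ`-value differs from `Φ y` only
  -- by `Q (P y - y)`.
  refine ⟨γ (σ (y - c)), hγfix _ hs (hψ0 (abs_lt.1 hs)), ?_⟩
  refine (hlow _ (hγmem _ hs) y (hsub hy)).trans ?_
  have h1 : Φ (γ (σ (y - c))) - Φ y = -Q (P y - y) := by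
    rw [hγΦ _ hs]
    simp only [Φ]
    abel
  rw [h1, norm_neg, mul_assoc]
  rw [mul_assoc, mul_assoc]
  gcongr
  exact hQle _

end Reduction

/-! ### Proof of the main theorem. -/

theorem lemma2 {n : ℕ} (Ω : Set (EuclideanSpace ℝ (Fin n))) (hΩ : IsOpen Ω)
    (f : EuclideanSpace ℝ (Fin n) → EuclideanSpace ℝ (Fin n)) (hf : AnalyticOnNhd ℝ f Ω)
    (T : ℝ) (hT : 0 < T)
    (x₀ : ℝ → EuclideanSpace ℝ (Fin n)) (hx₀ : IsNonconstantPeriodicSolution Ω f T x₀)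
    (hfloquet : FloquetCondition f T x₀)
    (z₀ : ℝ → EuclideanSpace ℝ (Fin n)) (hz₀ : IsNormalizedAdjointSolution f T x₀ z₀)
    (εs : ℝ) (hεs : 0 < εs)
    (g : ℝ → EuclideanSpace ℝ (Fin n) → ℝ → EuclideanSpace ℝ (Fin n))
    (hg : IsAdmissiblePerturbation Ω T εs g)
    (θ₀ : ℝ) (hθ₀ : IsIsolatedZero (malkinFunction T g x₀ z₀) θ₀) :
    ∃ ε₀ > 0, ∃ R > 0, ε₀ ≤ εs ∧ ∀ ε ∈ Set.Ioo 0 ε₀,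
      Metric.ball (x₀ θ₀) R ⊆ poincareDomain Ω (perturbedField f g ε) T ∧
      {ζ ∈ Metric.ball (x₀ θ₀) R |
        Function.IsFixedPt (poincareMap Ω (perturbedField f g ε) T) ζ}.Finite := by
  obtain ⟨ρ, K, htube⟩ := exists_isTubeBound hΩ hf hεs hx₀ hT.ne' hg
  obtain ⟨C, hC, r, hr, hCr, hflow⟩ := htube.exists_flow_bound hT.le hf.continuousOn hx₀ hg
  have hb : IsFlowBound Ω f T εs x₀ g C r := hflow
  obtain ⟨Z, hZ0, hZ, hZker, hZleft⟩ := exists_shifted_monodromy hf hT hx₀ hfloquet hz₀ θ₀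
  obtain ⟨κ, hκ, D, hD, hred⟩ := exists_lyapunovSchmidt_alternative (Z T) (x₀ θ₀) (f (x₀ θ₀))
    (z₀ θ₀) (hz₀.inner_velocity hx₀ θ₀) hZker hZleft
  obtain ⟨r', hr', hrr', hlin⟩ := hb.exists_approximatesLinear hC hr hCr htube hT hΩ hf hx₀ hZ0 hZ hκ
  -- Half of `r'` is reserved for `ε`. Neither `R` nor `ν` depends on `ε`, so `θ₁` can be fixed
  -- before `ε`.
  obtain ⟨R, hR, ν, hν, hRr, halt⟩ := hred (r' / 2) (half_pos hr')
  obtain ⟨θ₁, hMθ₁, hθ₁⟩ : ∃ θ₁, malkinFunction T g x₀ z₀ θ₁ ≠ 0 ∧ x₀ θ₁ ∈ ball (x₀ θ₀) R := by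
    have h1 : ∀ᶠ θ in 𝓝[≠] θ₀, x₀ θ ∈ ball (x₀ θ₀) R :=
      (hx₀.continuous.continuousAt.eventually (ball_mem_nhds _ hR)).filter_mono nhdsWithin_le_nhds
    exact (hθ₀.2.and h1).exists
  set Λ := Real.exp (K * T) * K with hΛ
  have hΛ0 : 0 < Λ := mul_pos (Real.exp_pos _) htube.K_pos
  -- The Poincaré map displaces orbit points by at most `Λ * ε`, so the reduction would yield a
  -- fixed point within `D * Λ * ε` of `x₀ θ₁`.
  obtain ⟨ε₁, hε₁, hmalkin⟩ := hb.eventually_not_isFixedPt hC hr hCr htube hT hΩ hf hx₀ hz₀ hεs hg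
    hMθ₁ (D := D * Λ) (by positivity)
  refine ⟨min εs (min (r' / 2) (min ε₁ (ν / Λ))), by positivity, R, hR, min_le_left _ _,
    fun ε hε => ?_⟩
  have hε0 : 0 < ε := hε.1
  have hεs' : ε ∈ Icc 0 εs := ⟨hε0.le, hε.2.le.trans (min_le_left _ _)⟩
  have hεr : ε < r' / 2 := hε.2.trans_le ((min_le_right _ _).trans (min_le_left _ _))
  have hεε₁ : ε < ε₁ := hε.2.trans_le
    ((min_le_right _ _).trans ((min_le_right _ _).trans (min_le_left _ _)))
  have hεν : Λ * ε ≤ ν := by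
    have := hε.2.le.trans ((min_le_right _ _).trans ((min_le_right _ _).trans (min_le_right _ _)))
    rwa [le_div_iff₀ hΛ0, mul_comm] at this
  have hball : ∀ ζ ∈ ball (x₀ θ₀) (r' / 2), ‖ζ - x₀ θ₀‖ + ε < r' := fun ζ hζ => by
    rw [mem_ball_iff_norm] at hζ
    linarith
  have horbit : ∀ θ, ‖poincareMap Ω (perturbedField f g ε) T (x₀ θ) - x₀ θ‖ ≤ Λ * ε := fun θ => by
    have h1 := hb.norm_poincareMap_sub_le hC hCr htube hT.le (θ := θ) hεs' (ζ := x₀ θ)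
      (by rw [sub_self, norm_zero]; linarith)
    rwa [hb.poincareMap_orbit hr.le hT.le hεs.le hx₀.periodic] at h1
  refine ⟨fun ζ hζ => (hb θ₀ ε hεs' ζ
    ((hball ζ (ball_subset_ball hRr hζ)).le.trans hrr')).1, ?_⟩
  refine (halt _ (fun ζ hζ => hb.analyticAt_poincareMap hC hCr htube hT hf hg hεs'
    ((hball ζ hζ).trans_le hrr')) (fun ζ hζ ζ' hζ' => hlin ε hεs' ζ ζ' (hball ζ hζ).le
    (hball ζ' hζ').le) ((horbit θ₀).trans hεν)).resolve_right fun hall => ?_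
  obtain ⟨ζ, hfix, hζ⟩ := hall _ hθ₁
  refine hmalkin ε hε0 hεε₁ ζ (hζ.trans ?_) hfix
  rw [mul_assoc]
  exact mul_le_mul_of_nonneg_left (horbit θ₁) hD.le
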